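/- Let $d$ be the hyperbolic distance on the upper half-plane $\mathbf H$. For integers $r\le p\le q$ with $r\ge 3$ and $1/r+1/p+1/q<1$, let $T$ be a hyperbolic triangle with angles $\pi/r,\pi/p,\pi/q$ at vertices $R,P,Q$, let $\Gamma_0(r,p,q)$ be the group generated by the reflections in the three sides of $T$, and let the triangle group $\Gamma(r,p,q)$ be the subgroup of its orientation-preserving elements. Let $q^*\in[R,P]$ be the point at which the inscribed circle of $T$ touches the side $[R,P]$, and let $\mathcal E^*$ be the set of all images of $q^*$ under $\Gamma_0(r,p,q)$. Two points $x,y\in\mathcal E^*$ are called neighbours if, for some $g\in\Gamma_0(r,p,q)$, either both lie on the circle with centre $gR$ and radius $d(R,q^*)$ and are seen from $gR$ under the angle $2\pi/r$, or both lie on the circle with centre $gP$ and radius $d(P,q^*)$ and are seen from $gP$ under the angle $2\pi/p$. Let $D^*(x,y)$ be the least number of edges of a path from $x$ to $y$ in the resulting graph on $\mathcal E^*$ ($+\infty$ if there is none). For $\gamma\in\Gamma(r,p,q)$ put $l(\gamma)=\inf_{x\in\mathbf H}d(x,\gamma x)$ and $\lambda^*(\gamma)=\inf_{x\in\mathcal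 E^*}D^*(x,\gamma x)$. Then for every $l_0>0$ there is an integer $n_0$, depending only on $l_0$, such that for all integers $3\le r\le p\le q$ with $1/r+1/p+1/q<1$, every triangle $T$ as above, and every hyperbolic element $\gamma\in\Gamma(r,p,q)$: $$l(\gamma)\le l_0\ \Longrightarrow\ \lambda^*(\gamma)<n_0 .$$ -/

import Mathlib

open scoped UpperHalfPlane

namespace TriangleGroup

/-! ### Plane hyperbolic geometry in the upper half-plane `ℍ` -/

/-- The geodesic segment `[a, b]`. -/
def segment (a b : ℍ) : Set ℍ := {x | dist a x + dist x b = dist a b}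

/-- The complete geodesic through two distinct points `a` and `b`. -/
def line (a b : ℍ) : Set ℍ := {x | x ∈ segment a b ∨ a ∈ segment x b ∨ b ∈ segment a x}

/-- Coordinate of `w` in the Poincaré disc centred at `z`: the conformal map
`w ↦ (w - z) / (w - z̄)` takes `ℍ` onto the unit disc, `z` to its centre, and the geodesic rays
issued from `z` to the radii. -/
noncomputable def discCoord (z w : ℍ) : ℂ := ((w : ℂ) - (z : ℂ)) / ((w : ℂ) - star (z : ℂ))

/-- The (unoriented) hyperbolic angle at the vertex `z` between the rays from `z` to `w₁`
and from `z` to `w₂`; it lies in `[0, π]`. -/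
noncomputable def angle (z w₁ w₂ : ℍ) : ℝ :=
  InnerProductGeometry.angle (discCoord z w₁) (discCoord z w₂)

/-- `σ` is the reflection in the geodesic through `a` and `b` (for `a ≠ b`): the nontrivial isometry
that fixes this geodesic pointwise. -/
def IsReflection (a b : ℍ) (σ : ℍ ≃ᵢ ℍ) : Prop := σ ≠ 1 ∧ ∀ x ∈ line a b, σ x = x

/-- The isometry `f` is given by the real matrix `g` of determinant one, through
`z ↦ (az + b) / (cz + d)`. -/
def IsMoebius (g : Matrix.SpecialLinearGroup (Fin 2) ℝ) (f : ℍ ≃ᵢ ℍ) : Prop :=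
  ∀ z : ℍ, f z = g • z

/-- The group of orientation preserving isometries of `ℍ`. -/
def directIsometries : Subgroup (ℍ ≃ᵢ ℍ) where
  carrier := {f | ∃ g, IsMoebius g f}
  one_mem' := ⟨1, fun z => by simp⟩
  mul_mem' := by
    rintro f f' ⟨g, hg⟩ ⟨g', hg'⟩
    refine ⟨g * g', fun z => ?_⟩
    rw [IsometryEquiv.mul_apply, hg' z, hg (g' • z), mul_smul]
  inv_mem' := by
    rintro f ⟨g, hg⟩
    refine ⟨g⁻¹, fun z => ?_⟩
    apply f.injective
    rw [hg (g⁻¹ • z), smul_inv_smul, IsometryEquiv.apply_inv_self]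

/-- Hyperbolic isometries: orientation preserving, given by a matrix with two distinct real
eigenvalues, i.e. of trace `t` with `t ^ 2 > 4`. -/
def IsHyperbolic (f : ℍ ≃ᵢ ℍ) : Prop :=
  ∃ g : Matrix.SpecialLinearGroup (Fin 2) ℝ,
    (g : Matrix (Fin 2) (Fin 2) ℝ).IsHyperbolic ∧ IsMoebius g f

/-- The translation distance `l(γ) = inf {d(x, γ x) ; x ∈ ℍ}`. -/
noncomputable def translationLength (γ : ℍ ≃ᵢ ℍ) : ℝ := ⨅ x : ℍ, dist x (γ x)

/-! ### Triangles and triangle groups -/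

/-- A triangle in `ℍ`, given by its three vertices. -/
structure Triangle where
  /-- first vertex -/
  R : ℍ
  /-- second vertex -/
  P : ℍ
  /-- third vertex -/
  Q : ℍ

/-- `T` has angles `π / r`, `π / p`, `π / q` at `R`, `P`, `Q`. -/
def Triangle.HasAngles (T : Triangle) (r p q : ℕ) : Prop :=
  angle T.R T.P T.Q = Real.pi / r ∧ angle T.P T.Q T.R = Real.pi / p ∧
    angle T.Q T.R T.P = Real.pi / q

/-- `Γ₀`, the group generated by the reflections in the three sides of `T`. -/
noncomputable def Triangle.fullGroup (T : Triangle) : Subgroup (ℍ ≃ᵢ ℍ) :=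
  Subgroup.closure
    {σ | IsReflection T.P T.Q σ ∨ IsReflection T.Q T.R σ ∨ IsReflection T.R T.P σ}

/-- `Γ`, the triangle group of `T`: the orientation preserving elements of `Γ₀`. -/
noncomputable def Triangle.group (T : Triangle) : Subgroup (ℍ ≃ᵢ ℍ) := T.fullGroup ⊓ directIsometries

/-! ### The combinatorial action -/

/-- The circle with centre `I` and radius `ρ` touches the side `[a, b]` at its point `x`,
and is tangent there to the geodesic through `a` and `b`. -/
def TouchesSideAt (I : ℍ) (ρ : ℝ) (a b x : ℍ) : Prop :=
  x ∈ segment a b ∧ dist I x = ρ ∧ ∀ y ∈ line a b, ρ ≤ dist I y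

/-- `c` is the point at which the inscribed circle of `T` touches the side `[R, P]`. -/
def Triangle.IsContactPoint (T : Triangle) (c : ℍ) : Prop :=
  ∃ (I : ℍ) (ρ : ℝ), 0 < ρ ∧ TouchesSideAt I ρ T.R T.P c ∧
    (∃ x, TouchesSideAt I ρ T.P T.Q x) ∧ ∃ y, TouchesSideAt I ρ T.Q T.R y

/-- The set `E*`: all images under `Γ₀` of the contact point on the side `[R, P]`. -/
def Triangle.EStar (T : Triangle) : Set ℍ :=
  {x | ∃ g ∈ T.fullGroup, ∃ c, T.IsContactPoint c ∧ x = g c}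

/-- `x, y ∈ E*` lie next to each other on a circle around an image `g V` of the vertex `V` of `T`.
The circle has the radius of the circle around `V` through the contact point, and consecutive
points are separated by the angle `2π / n`, if `T` has the angle `π / n` at `V`. -/
def Triangle.IsEdge (T : Triangle) (V : ℍ) (n : ℕ) (x y : ℍ) : Prop :=
  x ∈ T.EStar ∧ y ∈ T.EStar ∧ ∃ g ∈ T.fullGroup, ∃ c, T.IsContactPoint c ∧
    dist (g V) x = dist V c ∧ dist (g V) y = dist V c ∧ angle (g V) x y = 2 * Real.pi / n

/-- The graph of neighbours in `E*`, with its edges of type `r` (around the images of `R`) and of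
type `p` (around the images of `P`). Points outside `E*` are isolated. -/
def Triangle.graph (T : Triangle) (r p : ℕ) : SimpleGraph ℍ :=
  SimpleGraph.fromRel fun x y => T.IsEdge T.R r x y ∨ T.IsEdge T.P p x y

/-- The combinatorial distance `D*(x, y)`: the least number of edges of a path from `x` to `y`
(`⊤` if there is no path). -/
noncomputable def Triangle.DStar (T : Triangle) (r p : ℕ) (x y : ℍ) : ℕ∞ :=
  (T.graph r p).edist x y

/-- The minimal combinatorial displacement `λ*(γ) = inf {D*(x, γ x) ; x ∈ E*}`. -/
noncomputable def Triangle.lambdaStar (T : Triangle) (r p : ℕ) (γ : ℍ ≃ᵢ ℍ) : ℕ∞ :=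
  ⨅ x ∈ T.EStar, T.DStar r p x (γ x)

end TriangleGroup

namespace TriangleGroup

/-! ### Groups generated by reflections with dihedral Gram matrix -/

/-! In the hyperboloid model the group generated by the reflections in the sides of T is a
reflection group with explicit Gram matrix. One reflection moves the contact point by at most one
edge: the reflection in [P,Q] turns it about P, the one in [Q,R] turns it about R, and the one in
[R,P] fixes it. So λ* is at most the word length of any conjugate of γ (`edist_iso_le`), and it
suffices to bound this length, for a conjugate whose axis meets the chamber, in terms of l₀ alone.
The number of letters is the number of walls met by one period of the axis (`exists_gallery`). Three
successive walls with distinct letters contain two ultraparallel ones, at a distance bounded below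
independently of r, p, q (`six_fifths_le_form`), so this happens a bounded number of times per
period. Otherwise two letters alternate and the walls form a pencil through one vertex, where a run
can be long only if the angle π/m is small. This is where uniformity in q is at stake. A vertex with
angle π/m has an altitude h with sinh h ≥ 1/(2 sin(π/m)) (`altitude`), and any group element that
moves it does so by at least twice this altitude (`form_vertex_le`). For γ with translation length
bounded by l₀ the vertex must therefore be far from the axis when m is large. But the axis crosses
two walls of the pencil that enclose a definite angle if the run is long, which keeps the vertex
near the axis. Comparing the two gives K² ≤ 20κ for a run across K walls, with 1 + κ = cosh l(γ)
(`run_bound`). `len_le` adds up the windows. Tits' positivity of roots (`isPos_of_len_le`) supplies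
the relation between reduced words and walls throughout. -/

/-- A family of unit vectors `α i` in a quadratic space such that the angles between the hyperplanes
orthogonal to them are `π / m i j`. -/
structure RootDatum (ι V : Type*) [AddCommGroup V] [Module ℝ V] where
  /-- the bilinear form -/
  B : LinearMap.BilinForm ℝ V
  /-- the simple roots -/
  α : ι → V
  /-- the Coxeter matrix -/
  m : ι → ι → ℕ
  symm : ∀ u v, B u v = B v u
  norm : ∀ i, B (α i) (α i) = 1
  two_le : ∀ i j, i ≠ j → 2 ≤ m i j
  gram : ∀ i j, i ≠ j → B (α i) (α j) = -Real.cos (Real.pi / m i j)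

namespace RootDatum

variable {ι V : Type*} [AddCommGroup V] [Module ℝ V] (D : RootDatum ι V)

/-- The reflection in the simple root `α i`. -/
noncomputable def refl (i : ι) : Module.End ℝ V :=
  1 - (2 : ℝ) • (D.B (D.α i)).smulRight (D.α i)

theorem refl_apply (i : ι) (v : V) : D.refl i v = v - (2 * D.B (D.α i) v) • D.α i := by
  simp [refl, smul_smul]

theorem refl_root (i : ι) : D.refl i (D.α i) = -D.α i := by
  rw [refl_apply, D.norm, mul_one, two_smul]; abel

theorem refl_refl (i : ι) (v : V) : D.refl i (D.refl i v) = v := by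
  rw [D.refl_apply i v, map_sub, map_smul, refl_root, refl_apply]; module

theorem refl_mul_refl (i : ι) : D.refl i * D.refl i = 1 := by
  ext v; simp [refl_refl]

theorem refl_of_orthogonal {i : ι} {v : V} (h : D.B (D.α i) v = 0) : D.refl i v = v := by
  simp [refl_apply, h]

theorem form_refl_left (i : ι) (u v : V) : D.B (D.refl i u) v = D.B u (D.refl i v) := by
  simp only [refl_apply, map_sub, map_smul, LinearMap.sub_apply, LinearMap.smul_apply, smul_eq_mul]
  rw [D.symm u (D.α i)]; ring

/-- The product of the reflections in the letters of a word. -/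
noncomputable def wp (l : List ι) : Module.End ℝ V := (l.map D.refl).prod

@[simp] theorem wp_nil : D.wp [] = 1 := rfl

@[simp] theorem wp_cons (i : ι) (l : List ι) : D.wp (i :: l) = D.refl i * D.wp l := by simp [wp]

@[simp] theorem wp_append (l l' : List ι) : D.wp (l ++ l') = D.wp l * D.wp l' := by simp [wp]

theorem form_wp_left (l : List ι) (u v : V) :
    D.B (D.wp l u) v = D.B u (D.wp l.reverse v) := by
  induction l generalizing u v with
  | nil => simp
  | cons i l ih => simp [form_refl_left, ih]

theorem wp_reverse_mul (l : List ι) : D.wp l.reverse * D.wp l = 1 := by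
  induction l with
  | nil => simp
  | cons i l ih =>
    simp only [List.reverse_cons, wp_append, wp_cons, wp_nil, mul_one]
    rw [mul_assoc, ← mul_assoc (D.refl i), refl_mul_refl, one_mul, ih]

theorem wp_mul_reverse (l : List ι) : D.wp l * D.wp l.reverse = 1 := by
  simpa using D.wp_reverse_mul l.reverse

theorem wp_reverse_wp (l : List ι) (v : V) : D.wp l.reverse (D.wp l v) = v := by
  rw [← Module.End.mul_apply, wp_reverse_mul, Module.End.one_apply]

theorem wp_wp_reverse (l : List ι) (v : V) : D.wp l (D.wp l.reverse v) = v := by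
  rw [← Module.End.mul_apply, wp_mul_reverse, Module.End.one_apply]

theorem form_wp_wp (l : List ι) (u v : V) : D.B (D.wp l u) (D.wp l v) = D.B u v := by
  rw [form_wp_left, wp_reverse_wp]

theorem wp_reverse_congr {l l' : List ι} (h : D.wp l = D.wp l') :
    D.wp l.reverse = D.wp l'.reverse := by
  calc D.wp l.reverse = D.wp l.reverse * (D.wp l' * D.wp l'.reverse) := by
        rw [wp_mul_reverse, mul_one]
    _ = D.wp l'.reverse := by rw [← h, ← mul_assoc, wp_reverse_mul, one_mul]

/-- The word length. -/
noncomputable def len (f : Module.End ℝ V) : ℕ := sInf {k | ∃ l : List ι, D.wp l = f ∧ l.length = k}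

theorem len_wp_le (l : List ι) : D.len (D.wp l) ≤ l.length := Nat.sInf_le ⟨l, rfl, rfl⟩

/-- For an operator that is not a product of reflections the infimum is over the empty set and `len`
is 0; lengths are therefore used only for operators of the form `wp l`. -/
theorem exists_reduced (l : List ι) : ∃ l', D.wp l' = D.wp l ∧ l'.length = D.len (D.wp l) :=
  Nat.sInf_mem (s := {k | ∃ l' : List ι, D.wp l' = D.wp l ∧ l'.length = k}) ⟨_, l, rfl, rfl⟩

@[simp] theorem len_one : D.len 1 = 0 := by simpa using D.len_wp_le []

theorem len_wp_append_le (l l' : List ι) : D.len (D.wp (l ++ l')) ≤ D.len (D.wp l) + l'.length := by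
  obtain ⟨k, hk, hk'⟩ := D.exists_reduced l
  rw [← hk', ← List.length_append, wp_append, ← hk, ← wp_append]
  exact D.len_wp_le _

theorem len_reverse_le (l : List ι) : D.len (D.wp l.reverse) ≤ D.len (D.wp l) := by
  obtain ⟨k, hk, hk'⟩ := D.exists_reduced l
  rw [← hk', ← D.wp_reverse_congr hk]
  simpa using D.len_wp_le k.reverse

theorem len_reverse (l : List ι) : D.len (D.wp l.reverse) = D.len (D.wp l) :=
  le_antisymm (D.len_reverse_le l) (by simpa using D.len_reverse_le l.reverse)

/-! ### Dihedral words -/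

/-- The alternating word `a b a b …` of length `k`. -/
def alt (a b : ι) : ℕ → List ι
  | 0 => []
  | k + 1 => a :: alt b a k
termination_by k => k

/-- The letter that follows `alt a b k`. -/
def nxt (a b : ι) : ℕ → ι
  | 0 => a
  | k + 1 => nxt b a k
termination_by k => k

@[simp] theorem alt_zero (a b : ι) : alt a b 0 = [] := by simp [alt]
theorem alt_succ (a b : ι) (k : ℕ) : alt a b (k + 1) = a :: alt b a k := by simp [alt]
@[simp] theorem nxt_zero (a b : ι) : nxt a b 0 = a := by simp [nxt]
theorem nxt_succ (a b : ι) (k : ℕ) : nxt a b (k + 1) = nxt b a k := by simp [nxt]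

@[simp] theorem length_alt (a b : ι) (k : ℕ) : (alt a b k).length = k := by
  induction k generalizing a b with
  | zero => simp
  | succ k ih => simp [alt_succ, ih]

theorem alt_succ' (a b : ι) (k : ℕ) : alt a b (k + 1) = alt a b k ++ [nxt a b k] := by
  induction k generalizing a b with
  | zero => simp [alt_succ]
  | succ k ih => rw [alt_succ, ih, alt_succ a b k, nxt_succ, List.cons_append]

theorem nxt_or (a b : ι) (k : ℕ) :
    (nxt a b k = a ∧ nxt b a k = b) ∨ (nxt a b k = b ∧ nxt b a k = a) := by
  induction k with
  | zero => simp
  | succ k ih => rw [nxt_succ, nxt_succ]; tauto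

theorem exists_alt_append (a b : ι) {k n : ℕ} (h : k ≤ n) :
    ∃ l, alt a b n = alt a b k ++ l ∧ l.length = n - k := by
  induction n, h using Nat.le_induction with
  | base => exact ⟨[], by simp⟩
  | succ n hn ih =>
    obtain ⟨l, h1, h2⟩ := ih
    refine ⟨l ++ [nxt a b n], by rw [alt_succ', h1, List.append_assoc], ?_⟩
    simp [h2]; omega

theorem m_comm_cos {a b : ι} (hab : a ≠ b) :
    Real.cos (Real.pi / D.m b a) = Real.cos (Real.pi / D.m a b) := by
  have h1 := D.gram a b hab
  have h2 := D.gram b a hab.symm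
  rw [D.symm] at h2; linarith

theorem sin_pos {a b : ι} (hab : a ≠ b) : 0 < Real.sin (Real.pi / D.m a b) := by
  have h2 : (2 : ℝ) ≤ D.m a b := by exact_mod_cast D.two_le a b hab
  apply Real.sin_pos_of_pos_of_lt_pi (by have := Real.pi_pos; positivity)
  rw [div_lt_iff₀ (by linarith)]; nlinarith [Real.pi_pos]

/-- The roots of a dihedral subgroup. -/
theorem sin_smul_wp_alt {a b : ι} (hab : a ≠ b) {θ : ℝ} (hθ : D.B (D.α a) (D.α b) = -Real.cos θ)
    (k : ℕ) : Real.sin θ • D.wp (alt a b k) (D.α (nxt a b k)) =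
      Real.sin ((k + 1) * θ) • D.α a + Real.sin (k * θ) • D.α b := by
  induction k generalizing a b with
  | zero => simp
  | succ k ih =>
    rw [alt_succ, nxt_succ, wp_cons, Module.End.mul_apply, ← map_smul,
      ih hab.symm (by rw [D.symm]; exact hθ), map_add, map_smul, map_smul, refl_root, refl_apply, hθ]
    -- The new coefficient is given by the three-term recurrence of Chebyshev.
    have h : Real.sin ((k + 1 + 1) * θ) + Real.sin (k * θ) =
        2 * Real.sin ((k + 1) * θ) * Real.cos θ := by
      rw [show ((k : ℝ) + 1 + 1) * θ = (k + 1) * θ + θ by ring,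
        show (k : ℝ) * θ = (k + 1) * θ - θ by ring, Real.sin_add, Real.sin_sub]; ring
    have h' : Real.sin ((k + 1 + 1) * θ) =
        2 * Real.sin ((k + 1) * θ) * Real.cos θ - Real.sin (k * θ) := by linarith
    push_cast
    rw [h']
    module

theorem wp_alt_root {a b : ι} (hab : a ≠ b) (k : ℕ) :
    D.wp (alt a b k) (D.α (nxt a b k)) =
      (Real.sin ((k + 1) * (Real.pi / D.m a b)) / Real.sin (Real.pi / D.m a b)) • D.α a +
      (Real.sin (k * (Real.pi / D.m a b)) / Real.sin (Real.pi / D.m a b)) • D.α b := by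
  have h := D.sin_smul_wp_alt hab (D.gram a b hab) k
  have hs := (D.sin_pos hab).ne'
  rw [← smul_right_inj hs, h, smul_add, smul_smul, smul_smul, mul_div_cancel₀ _ hs,
    mul_div_cancel₀ _ hs]

end RootDatum

/-! ### The braid relation -/

namespace RootDatum

variable {ι V : Type*} [AddCommGroup V] [Module ℝ V] (D : RootDatum ι V)

theorem m_mul_angle {a b : ι} (hab : a ≠ b) : (D.m a b : ℝ) * (Real.pi / D.m a b) = Real.pi := by
  have h2 : (2 : ℝ) ≤ D.m a b := by exact_mod_cast D.two_le a b hab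
  field_simp

/-- With θ = π/m the coefficients at step m are sin(π + θ)/sin θ = -1 and sin π = 0. -/
theorem wp_alt_m_nxt {a b : ι} (hab : a ≠ b) :
    D.wp (alt a b (D.m a b)) (D.α (nxt a b (D.m a b))) = -D.α a := by
  have hs := (D.sin_pos hab).ne'
  rw [wp_alt_root D hab, add_mul, D.m_mul_angle hab, one_mul, Real.sin_pi,
    add_comm Real.pi, Real.sin_add_pi, neg_div, div_self hs]
  simp

/-- The last letter changes the sign of its root, and the other m - 1 letters carry that root to `α
a`, since the coefficients are then sin π = 0 and sin(π - θ)/sin θ = 1. -/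
theorem wp_alt_m_nxt' {a b : ι} (hab : a ≠ b) :
    D.wp (alt b a (D.m a b)) (D.α (nxt a b (D.m a b))) = -D.α a := by
  have hs := (D.sin_pos hab).ne'
  have hm := D.m_mul_angle hab
  obtain ⟨k, hk⟩ : ∃ k, D.m a b = k + 1 := ⟨D.m a b - 1, by have := D.two_le a b hab; omega⟩
  have h := D.sin_smul_wp_alt hab.symm (θ := Real.pi / D.m a b)
    (by rw [D.symm]; exact D.gram a b hab) k
  rw [hk] at h hm hs ⊢
  push_cast at hm h hs ⊢
  rw [hm, Real.sin_pi, show (k : ℝ) * (Real.pi / (k + 1)) = Real.pi - Real.pi / (k + 1) by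
    linear_combination hm, Real.sin_pi_sub, zero_smul, zero_add, smul_right_inj hs] at h
  rw [alt_succ', nxt_succ, wp_append, wp_cons, wp_nil, mul_one, Module.End.mul_apply, refl_root,
    map_neg, h]

theorem wp_alt_of_orthogonal {a b : ι} {v : V} (ha : D.B (D.α a) v = 0) (hb : D.B (D.α b) v = 0)
    (k : ℕ) : D.wp (alt a b k) v = v := by
  induction k generalizing a b with
  | zero => simp
  | succ k ih =>
    rw [alt_succ, wp_cons, Module.End.mul_apply, ih hb ha, D.refl_of_orthogonal ha]

/-- The Gram determinant of `α a`, `α b` is sin²(π/m) > 0, so the plane they span splits off; the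
witnesses solve the 2 × 2 system. -/
theorem exists_orthogonal_part {a b : ι} (hab : a ≠ b) (v : V) :
    ∃ x y : ℝ, ∃ o : V, v = x • D.α a + y • D.α b + o ∧ D.B (D.α a) o = 0 ∧ D.B (D.α b) o = 0 := by
  set c := Real.cos (Real.pi / D.m a b) with hc
  set s := Real.sin (Real.pi / D.m a b) with hs
  have hs0 : s ≠ 0 := (D.sin_pos hab).ne'
  have hcs : s ^ 2 + c ^ 2 = 1 := Real.sin_sq_add_cos_sq _
  have hg := D.gram a b hab
  have hg' : D.B (D.α b) (D.α a) = -c := by rw [D.symm]; exact hg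
  set p := D.B (D.α a) v
  set q := D.B (D.α b) v
  refine ⟨(p + c * q) / s ^ 2, (q + c * p) / s ^ 2,
    v - (((p + c * q) / s ^ 2) • D.α a + ((q + c * p) / s ^ 2) • D.α b), by abel, ?_, ?_⟩
  · simp only [map_sub, map_add, map_smul, smul_eq_mul, D.norm, hg]
    rw [← hc]; field_simp
    change p * s ^ 2 - _ = _
    linear_combination p * hcs
  · simp only [map_sub, map_add, map_smul, smul_eq_mul, D.norm, hg']
    field_simp
    change q * s ^ 2 - _ = _
    linear_combination q * hcs

/-- Both sides agree on the two roots and fix the orthogonal complement of their span. -/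
theorem wp_alt_m_comm {a b : ι} (hab : a ≠ b) :
    D.wp (alt a b (D.m a b)) = D.wp (alt b a (D.m a b)) := by
  have h1 : ∀ c, c = a ∨ c = b →
      D.wp (alt a b (D.m a b)) (D.α c) = D.wp (alt b a (D.m a b)) (D.α c) := by
    have e1 : D.wp (alt a b (D.m a b)) (D.α (nxt a b (D.m a b))) =
        D.wp (alt b a (D.m a b)) (D.α (nxt a b (D.m a b))) := by
      rw [D.wp_alt_m_nxt hab, D.wp_alt_m_nxt' hab]
    -- Symmetry of `m` is not assumed; it follows from that of the form, cos being injective on [0,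
    -- π].
    have hmm : D.m b a = D.m a b := by
      have h := D.m_comm_cos hab
      have h2 : (2 : ℝ) ≤ D.m a b := by exact_mod_cast D.two_le a b hab
      have h2' : (2 : ℝ) ≤ D.m b a := by exact_mod_cast D.two_le b a hab.symm
      have hpi := Real.pi_pos
      have := Real.injOn_cos ⟨by positivity, by rw [div_le_iff₀ (by linarith)]; nlinarith⟩
        ⟨by positivity, by rw [div_le_iff₀ (by linarith)]; nlinarith⟩ h
      field_simp at this
      exact_mod_cast this.symm
    have e2 : D.wp (alt a b (D.m a b)) (D.α (nxt b a (D.m a b))) =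
        D.wp (alt b a (D.m a b)) (D.α (nxt b a (D.m a b))) := by
      rw [← hmm, D.wp_alt_m_nxt hab.symm, D.wp_alt_m_nxt' hab.symm]
    rcases nxt_or a b (D.m a b) with ⟨h, h'⟩ | ⟨h, h'⟩ <;> rw [h] at e1 <;> rw [h'] at e2 <;>
      rintro c (rfl | rfl) <;> assumption
  ext v
  obtain ⟨x, y, o, rfl, ha, hb⟩ := D.exists_orthogonal_part hab v
  simp only [map_add, map_smul, h1 a (.inl rfl), h1 b (.inr rfl), D.wp_alt_of_orthogonal ha hb,
    D.wp_alt_of_orthogonal hb ha]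

/-- Alternating words of length exceeding `m a b` are not reduced. -/
theorem exists_shorter_alt {a b : ι} (hab : a ≠ b) {k : ℕ} (hk : D.m a b ≤ k) :
    ∃ l, D.wp l = D.wp (alt a b (k + 1)) ∧ l.length + 2 = k + 1 := by
  obtain ⟨n, hn⟩ : ∃ n, D.m a b = n + 1 := ⟨D.m a b - 1, by have := D.two_le a b hab; omega⟩
  have h := D.wp_alt_m_comm hab
  obtain ⟨l, hl, hl'⟩ := exists_alt_append a b (show D.m a b + 1 ≤ k + 1 by omega)
  -- The first m + 1 letters are `a` followed by `alt b a m`. The braid relation turns the latter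
  -- into `alt a b m`; two letters `a` cancel and `alt b a n` remains.
  refine ⟨alt b a n ++ l, ?_, by simp [hl']; omega⟩
  rw [hl, wp_append, wp_append, alt_succ, wp_cons, ← h, hn, alt_succ, wp_cons, ← mul_assoc,
    refl_mul_refl, one_mul]

/-! ### Positivity of roots -/

/-- `v` is nonnegative on the fundamental chamber. -/
def IsPos (v : V) : Prop := ∀ x, (∀ i, 0 ≤ D.B (D.α i) x) → 0 ≤ D.B v x

theorem isPos_root (i : ι) : D.IsPos (D.α i) := fun _ hx => hx i

theorem IsPos.combo {D : RootDatum ι V} {u v : V} (hu : D.IsPos u) (hv : D.IsPos v) {x y : ℝ}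
    (hx : 0 ≤ x) (hy : 0 ≤ y) : D.IsPos (x • u + y • v) := fun z hz => by
  have := hu z hz
  have := hv z hz
  simp only [map_add, map_smul, LinearMap.add_apply, LinearMap.smul_apply, smul_eq_mul]
  positivity

theorem len_wp_concat_le (l : List ι) (i : ι) : D.len (D.wp l * D.refl i) ≤ D.len (D.wp l) + 1 := by
  simpa using D.len_wp_append_le l [i]

theorem le_len_wp_concat (l : List ι) (i : ι) : D.len (D.wp l) ≤ D.len (D.wp l * D.refl i) + 1 := by
  have := D.len_wp_concat_le (l ++ [i]) i
  simpa [mul_assoc, refl_mul_refl] using this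

/-- Tits: if multiplication on the right by the reflection in `α s` does not decrease the length
then the image of `α s` is positive. -/
theorem isPos_of_len_le (l : List ι) (s : ι) (h : D.len (D.wp l) ≤ D.len (D.wp l * D.refl s)) :
    D.IsPos (D.wp l (D.α s)) := by
  induction hn : D.len (D.wp l) using Nat.strong_induction_on generalizing l s with
  | _ n ih =>
  obtain ⟨r, hr, hr'⟩ := D.exists_reduced l
  rcases List.eq_nil_or_concat r with rfl | ⟨r, t, rfl⟩
  · rw [← hr]; simpa using D.isPos_root s
  rw [List.concat_eq_append] at hr hr'
  have hst : t ≠ s := by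
    rintro rfl
    have : D.wp l * D.refl t = D.wp r := by
      rw [← hr]; simp [mul_assoc, refl_mul_refl]
    rw [this] at h
    have := D.len_wp_le r
    simp at hr'; omega
  -- lengths of alternating final segments of reduced expressions
  let S : Set ℕ := {k | ∃ a b : ι, ((a = s ∧ b = t) ∨ (a = t ∧ b = s)) ∧ nxt a b k = s ∧
    ∃ v, D.wp l = D.wp v * D.wp (alt a b k) ∧ D.len (D.wp v) + k = D.len (D.wp l)}
  have hS1 : 1 ∈ S := by
    refine ⟨t, s, .inr ⟨rfl, rfl⟩, by simp [nxt_succ], r, ?_, ?_⟩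
    · rw [← hr]; simp [alt_succ]
    · have h1 := D.len_wp_le r
      have h2 := D.len_wp_concat_le r t
      simp at hr' hr; rw [hr] at h2; omega
  have hSb : BddAbove S := ⟨D.len (D.wp l), by rintro k ⟨a, b, -, -, v, -, hv⟩; omega⟩
  have hmax : ∀ k ∈ S, k ≤ sSup S := fun k hk => le_csSup hSb hk
  -- Take the longest alternating suffix in the letters `s`, `t`. The remaining factor `v` is
  -- strictly shorter, so the induction hypothesis applies to it, for both letters.
  obtain ⟨a, b, hab, hnxt, v, hv, hvl⟩ := Nat.sSup_mem ⟨1, hS1⟩ hSb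
  have hk1 : 1 ≤ sSup S := hmax 1 hS1
  generalize sSup S = k at *
  have hne : a ≠ b := by rcases hab with ⟨rfl, rfl⟩ | ⟨rfl, rfl⟩ <;> [exact hst.symm; exact hst]
  have hva : D.IsPos (D.wp v (D.α a)) := by
    refine ih _ (by omega) v a ?_ rfl
    obtain ⟨j, rfl⟩ : ∃ j, k = j + 1 := ⟨k - 1, by omega⟩
    have h1 := D.len_wp_append_le (v ++ [a]) (alt b a j)
    have h2 : D.wp (v ++ [a] ++ alt b a j) = D.wp l := by
      rw [hv, alt_succ]; simp
    rw [h2] at h1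
    simp at h1; omega
  have hvb : D.IsPos (D.wp v (D.α b)) := by
    refine ih _ (by omega) v b ?_ rfl
    -- If `v` became shorter by `b`, the alternating suffix could be prolonged, against maximality.
    by_contra hlt
    have h1 := D.le_len_wp_concat v b
    have := hmax (k + 1) ⟨b, a, by tauto, by rw [nxt_succ, hnxt], v ++ [b], ?_, ?_⟩
    · omega
    · rw [hv, alt_succ]
      simp only [wp_append, wp_cons, wp_nil, mul_one]
      rw [mul_assoc, ← mul_assoc (D.refl b), refl_mul_refl, one_mul]
    · simp; omega
  -- Otherwise the suffix together with `s` could be shortened, and right multiplication by `s`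
  -- would decrease the length.
  have hkm : k < D.m a b := by
    by_contra hk
    obtain ⟨q, hq, hq'⟩ := D.exists_shorter_alt hne (not_lt.1 hk)
    have h1 := D.len_wp_append_le v q
    have h2 : D.wp (v ++ q) = D.wp l * D.refl s := by
      rw [wp_append, hq, alt_succ', hnxt, hv]; simp [mul_assoc]
    rw [h2] at h1
    omega
  have hm := D.m_mul_angle hne
  have hpos : 0 < Real.pi / D.m a b := by
    have : (2 : ℝ) ≤ D.m a b := by exact_mod_cast D.two_le a b hne
    have := Real.pi_pos
    positivity
  have hsin : ∀ j : ℕ, j ≤ D.m a b → 0 ≤ Real.sin (j * (Real.pi / D.m a b)) := fun j hj => by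
    refine Real.sin_nonneg_of_nonneg_of_le_pi (by positivity) ?_
    calc (j : ℝ) * (Real.pi / D.m a b) ≤ D.m a b * (Real.pi / D.m a b) := by gcongr
      _ = Real.pi := hm
  have hc := D.wp_alt_root hne k
  rw [hv, Module.End.mul_apply, ← hnxt, hc, map_add, map_smul, map_smul]
  refine hva.combo hvb (div_nonneg ?_ (D.sin_pos hne).le)
    (div_nonneg (hsin k hkm.le) (D.sin_pos hne).le)
  exact_mod_cast hsin (k + 1) hkm

end RootDatum

/-! ### Displacement of points of the chamber -/

namespace RootDatum

variable {ι V : Type*} [AddCommGroup V] [Module ℝ V] (D : RootDatum ι V)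

/-- The closed fundamental chamber. -/
def chamber : Set V := {x | ∀ i, 0 ≤ D.B (D.α i) x}

theorem len_of_prefix {l l' : List ι} (h : D.len (D.wp (l ++ l')) = (l ++ l').length) :
    D.len (D.wp l) = l.length := by
  have h1 := D.len_wp_append_le l l'
  have h2 := D.len_wp_le l
  simp only [List.length_append] at h
  omega

/-- Appending a letter on the right of a reduced word subtracts twice a product of two numbers that
are nonnegative by positivity of roots. Hence all letters but the first may be dropped. -/
theorem form_wp_cons_le {i : ι} {l : List ι} (h : D.len (D.wp (i :: l)) = (i :: l).length) {x y : V}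
    (hx : x ∈ D.chamber) (hy : y ∈ D.chamber) :
    D.B y (D.wp (i :: l) x) ≤ D.B y x - 2 * (D.B (D.α i) x * D.B (D.α i) y) := by
  induction l using List.reverseRecOn with
  | nil =>
    simp only [wp_cons, wp_nil, mul_one, refl_apply, map_sub, map_smul, smul_eq_mul]
    rw [D.symm y (D.α i)]; linarith
  | append_singleton l j ih =>
    rw [← List.cons_append] at h ⊢
    have h1 := D.len_of_prefix h
    have h2 : 0 ≤ D.B (D.wp (i :: l) (D.α j)) y := by
      refine D.isPos_of_len_le (i :: l) j ?_ y hy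
      rw [wp_append, wp_cons D j, wp_nil, mul_one] at h
      rw [h, h1]; simp
    have h3 := ih h1
    have h4 := hx j
    rw [wp_append, Module.End.mul_apply, wp_cons D j, wp_nil, mul_one, refl_apply, map_sub, map_smul,
      map_sub, map_smul, smul_eq_mul, D.symm y (D.wp (i :: l) (D.α j))]
    nlinarith [mul_nonneg h4 h2]

/-- A vertex is displaced by at least twice the corresponding altitude. -/
theorem form_vertex_le {k : ι} {v : V} (hv : D.B v v = -1) (hk : 0 ≤ D.B (D.α k) v)
    (h0 : ∀ i, i ≠ k → D.B (D.α i) v = 0) (l : List ι) (hl : D.B v (D.wp l v) ≠ -1) :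
    D.B v (D.wp l v) ≤ -1 - 2 * D.B (D.α k) v ^ 2 := by
  induction hn : l.length using Nat.strong_induction_on generalizing l with
  | _ n ih =>
  by_cases hr : D.len (D.wp l) = l.length
  · cases l with
    | nil => simp [hv] at hl
    | cons i l =>
      by_cases hi : i = k
      · subst hi
        have hc : v ∈ D.chamber := fun j => by
          by_cases hj : j = i
          · rw [hj]; exact hk
          · rw [h0 j hj]
        have := D.form_wp_cons_le hr hc hc
        rw [hv] at this
        linarith
      · have h1 : D.B v (D.wp (i :: l) v) = D.B v (D.wp l v) := by
          rw [wp_cons, Module.End.mul_apply, ← form_refl_left, D.refl_of_orthogonal (h0 i hi)]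
        rw [h1] at hl ⊢
        exact ih l.length (by simp at hn; omega) l hl rfl
  · obtain ⟨r, hr1, hr2⟩ := D.exists_reduced l
    have := D.len_wp_le l
    rw [← hr1] at hl ⊢
    exact ih r.length (by omega) r hl rfl

/-! ### Galleries along segments -/

/-- The product of the first `n` letters of the sequence `w`. -/
noncomputable def pw (w : ℕ → ι) (n : ℕ) : Module.End ℝ V := D.wp ((List.range n).map w)

@[simp] theorem pw_zero (w : ℕ → ι) : D.pw w 0 = 1 := by simp [pw]

theorem pw_succ (w : ℕ → ι) (n : ℕ) : D.pw w (n + 1) = D.pw w n * D.refl (w n) := by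
  simp [pw, List.range_succ]

theorem pw_succ' (w : ℕ → ι) (n : ℕ) :
    D.pw w (n + 1) = D.refl (w 0) * D.pw (fun j => w (j + 1)) n := by
  simp [pw, List.range_succ_eq_map, Function.comp_def]

/-- A wall of the chamber that strictly separates it from the image of a chamber point shortens the
word: this is the contrapositive of Tits' lemma for the inverse word. -/
theorem len_cons_of_neg {l : List ι} {i : ι} {y : V} (hy : y ∈ D.chamber)
    (h : D.B (D.α i) (D.wp l y) < 0) : D.len (D.wp (i :: l)) + 1 = D.len (D.wp l) := by
  have h1 : ¬ D.len (D.wp l.reverse) ≤ D.len (D.wp l.reverse * D.refl i) := fun h' => by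
    have := D.isPos_of_len_le l.reverse i h' y hy
    rw [form_wp_left, List.reverse_reverse] at this
    linarith
  have h2 := D.le_len_wp_concat l.reverse i
  have h3 : D.wp l.reverse * D.refl i = D.wp (i :: l).reverse := by simp
  rw [h3, len_reverse, len_reverse] at h1 h2
  omega

theorem form_nonpos_of_len {l : List ι} {i : ι} {y : V} (hy : y ∈ D.chamber)
    (h : D.len (D.wp (i :: l)) ≤ D.len (D.wp l)) : D.B (D.α i) (D.wp l y) ≤ 0 := by
  have h3 : D.wp (i :: l).reverse = D.wp l.reverse * D.refl i := by simp
  have h1 := D.isPos_of_len_le (i :: l).reverse i (by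
    rw [h3, mul_assoc, refl_mul_refl, mul_one, ← h3, len_reverse, len_reverse]; exact h) y hy
  rw [h3, Module.End.mul_apply, refl_root, map_neg, map_neg, LinearMap.neg_apply, form_wp_left,
    List.reverse_reverse] at h1
  linarith

/-- The segment from `x` to `wp l y` is followed until it leaves the chamber; after reflection in
the wall crossed there, the rest of the segment starts in the chamber again and belongs to a word
shorter by one. Here `t j` is the affine parameter at which the wall with index `j` is met. -/
theorem exists_gallery [Finite ι] [Nonempty ι] (n : ℕ) (l : List ι) (hn : D.len (D.wp l) = n)
    (x y : V) (hx : x ∈ D.chamber) (hy : y ∈ D.chamber) :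
    ∃ (w : ℕ → ι) (t : ℕ → ℝ), D.pw w n = D.wp l ∧ Monotone t ∧ (∀ j, 0 ≤ t j ∧ t j ≤ 1) ∧
      ∀ j < n, D.B (D.pw w j (D.α (w j))) ((1 - t j) • x + t j • D.wp l y) = 0 := by
  induction n generalizing l x with
  | zero =>
    obtain ⟨r, hr, hr'⟩ := D.exists_reduced l
    rw [hn, List.length_eq_zero_iff] at hr'
    refine ⟨fun _ => Classical.arbitrary ι, fun _ => 1, ?_, monotone_const, by simp, by simp⟩
    rw [← hr, hr']; simp
  | succ n ih =>
    obtain ⟨i, s, hs0, hs1, hx1, hi, hlen⟩ : ∃ (i : ι) (s : ℝ), 0 ≤ s ∧ s ≤ 1 ∧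
        (1 - s) • x + s • D.wp l y ∈ D.chamber ∧
        D.B (D.α i) ((1 - s) • x + s • D.wp l y) = 0 ∧ D.len (D.wp (i :: l)) = n := by
      by_cases hneg : ∃ i, D.B (D.α i) (D.wp l y) < 0
      -- The quotient is the parameter at which the wall of `i` is met; the smallest one is the exit
      -- from the chamber.
      · obtain ⟨i, hi, hmin⟩ := Set.exists_min_image {i | D.B (D.α i) (D.wp l y) < 0}
          (fun i => D.B (D.α i) x / (D.B (D.α i) x - D.B (D.α i) (D.wp l y))) (Set.toFinite _) hneg
        simp only [Set.mem_ofPred_eq] at hi hmin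
        have hxi := hx i
        have hpos : 0 < D.B (D.α i) x - D.B (D.α i) (D.wp l y) := by linarith
        have hs0 := div_nonneg hxi hpos.le
        have hs1 : D.B (D.α i) x / (D.B (D.α i) x - D.B (D.α i) (D.wp l y)) ≤ 1 := by
          rw [div_le_one hpos]; linarith
        refine ⟨i, _, hs0, hs1, fun j => ?_, ?_, ?_⟩
        · have hxj := hx j
          simp only [map_add, map_smul, smul_eq_mul]
          by_cases hj : D.B (D.α j) (D.wp l y) < 0
          · have := hmin j hj
            rw [le_div_iff₀ (by linarith)] at this
            linarith
          · exact add_nonneg (mul_nonneg (by linarith) hxj) (mul_nonneg hs0 (not_lt.1 hj))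
        · simp only [map_add, map_smul, smul_eq_mul]
          field_simp; ring
        · have := D.len_cons_of_neg hy hi
          omega
      -- The endpoint lies in the chamber although letters remain. Then it lies on the wall of the
      -- first letter of a reduced word, which is met at parameter 1.
      · push Not at hneg
        obtain ⟨r, hr, hr'⟩ := D.exists_reduced l
        cases r with
        | nil => simp [hn] at hr'
        | cons i r =>
          have hir : D.wp (i :: l) = D.wp r := by
            rw [wp_cons, ← hr, wp_cons, ← mul_assoc, refl_mul_refl, one_mul]
          have h1 : D.len (D.wp (i :: l)) ≤ n := by
            rw [hir]; have := D.len_wp_le r; simp at hr'; omega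
          have h2 := D.form_nonpos_of_len (l := l) (i := i) hy (by omega)
          have h3 := D.le_len_wp_concat l.reverse i
          have h4 : D.wp l.reverse * D.refl i = D.wp (i :: l).reverse := by simp
          rw [h4, len_reverse, len_reverse] at h3
          refine ⟨i, 1, zero_le_one, le_rfl, fun j => by simpa using hneg j, ?_, by omega⟩
          simpa using le_antisymm h2 (hneg i)
    obtain ⟨w, t, hw, ht, ht01, hB⟩ := ih (i :: l) hlen _ hx1
    refine ⟨fun j => Nat.casesOn j i w, fun j => Nat.casesOn j s (fun j => s + (1 - s) * t j),
      ?_, ?_, ?_, ?_⟩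
    · rw [pw_succ']
      change D.refl i * D.pw w n = _
      rw [hw, wp_cons, ← mul_assoc, refl_mul_refl, one_mul]
    · refine monotone_nat_of_le_succ fun j => ?_
      cases j with
      | zero => change s ≤ s + (1 - s) * t 0; nlinarith [ht01 0]
      | succ j =>
        change s + (1 - s) * t j ≤ s + (1 - s) * t (j + 1)
        nlinarith [ht (Nat.le_succ j)]
    · intro j
      cases j with
      | zero => exact ⟨hs0, hs1⟩
      | succ j =>
        change 0 ≤ s + (1 - s) * t j ∧ s + (1 - s) * t j ≤ 1
        constructor <;> nlinarith [ht01 j]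
    · intro j hj
      cases j with
      | zero => simpa using hi
      | succ j =>
        have h := hB j (by omega)
        simp only [pw_succ', Module.End.mul_apply, form_refl_left]
        convert h using 2
        have hxx := D.refl_of_orthogonal hi
        rw [wp_cons, Module.End.mul_apply]
        -- The tail of the segment, reparametrised from its crossing point, which the reflection
        -- fixes.
        have e : (1 - (s + (1 - s) * t j)) • x + (s + (1 - s) * t j) • D.wp l y =
            (1 - t j) • ((1 - s) • x + s • D.wp l y) + t j • D.wp l y := by module
        change D.refl i ((1 - (s + (1 - s) * t j)) • x + (s + (1 - s) * t j) • D.wp l y) = _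
        rw [e, map_add, map_smul, map_smul, hxx]

end RootDatum

/-! ### Alternating runs in reduced galleries -/

namespace RootDatum

variable {ι V : Type*} [AddCommGroup V] [Module ℝ V] (D : RootDatum ι V)

theorem pw_add_alt {w : ℕ → ι} {j K : ℕ} {a b : ι} (h : ∀ e < K, w (j + e) = nxt a b e) :
    D.pw w (j + K) = D.pw w j * D.wp (alt a b K) := by
  induction K with
  | zero => simp
  | succ K ih =>
    rw [← add_assoc, pw_succ, ih fun e he => h e (by omega), h K (by omega), alt_succ', wp_append,
      wp_cons, wp_nil, mul_one, mul_assoc]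

theorem len_pw {w : ℕ → ι} {n : ℕ} (h : D.len (D.pw w n) = n) {j : ℕ} (hj : j ≤ n) :
    D.len (D.pw w j) = j := by
  induction n, hj using Nat.le_induction with
  | base => exact h
  | succ n hn ih =>
    apply ih
    have h1 := D.len_wp_concat_le ((List.range n).map w) (w n)
    have h2 := D.len_wp_le ((List.range n).map w)
    simp only [List.length_map, List.length_range] at h2
    rw [pw_succ] at h
    change D.len (D.pw w n * _) ≤ D.len (D.pw w n) + 1 at h1
    change D.len (D.pw w n) ≤ n at h2
    omega

theorem ne_succ_of_reduced {w : ℕ → ι} {n : ℕ} (h : D.len (D.pw w n) = n) {j : ℕ}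
    (hj : j + 1 < n) : w j ≠ w (j + 1) := fun he => by
  have h1 := D.len_pw h (show j + 1 + 1 ≤ n by omega)
  have h2 := D.len_pw h (show j ≤ n by omega)
  rw [pw_succ, pw_succ, ← he, mul_assoc, refl_mul_refl, mul_one] at h1
  omega

theorem le_m_of_reduced {w : ℕ → ι} {n : ℕ} (hn : D.len (D.pw w n) = n) {j K : ℕ} {a b : ι}
    (hab : a ≠ b) (h : ∀ e < K, w (j + e) = nxt a b e) (hj : j + K ≤ n) : K ≤ D.m a b := by
  by_contra hlt
  have h1 := D.pw_add_alt (K := D.m a b + 1) fun e he => h e (by omega)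
  obtain ⟨r, hr, hr'⟩ := D.exists_shorter_alt hab le_rfl
  have h2 := D.len_pw hn (show j + (D.m a b + 1) ≤ n by omega)
  have h3 := D.len_wp_append_le ((List.range j).map w) r
  have h4 := D.len_pw hn (show j ≤ n by omega)
  rw [wp_append, hr] at h3
  rw [h1] at h2
  change D.len (D.pw w j * _) ≤ D.len (D.pw w j) + _ at h3
  omega

end RootDatum

/-! ### Lorentzian inequalities -/

section Lorentz

variable {V : Type*} [AddCommGroup V] [Module ℝ V] {B : LinearMap.BilinForm ℝ V}

/-- The product is the cosine of the angle of two lines that meet in `z`: the form is semidefinite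
on the complement of the timelike vector `z`, and Cauchy–Schwarz applies there. -/
theorem sq_form_le_one (symm : ∀ u v, B u v = B v u)
    (lor : ∀ u w, B u u < 0 → B u u * B w w ≤ B u w ^ 2) {z n ρ : V} (hz : B z z < 0)
    (hn : B n n = 1) (hρ : B ρ ρ = 1) (hnz : B n z = 0) (hρz : B ρ z = 0) : B n ρ ^ 2 ≤ 1 := by
  have h := lor z (n - B n ρ • ρ) hz
  simp only [map_sub, map_smul, LinearMap.sub_apply, LinearMap.smul_apply, smul_eq_mul, hn, hρ,
    symm z, hnz, hρz, symm ρ n] at h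
  nlinarith

/-- The distance of two ultraparallel lines is a lower bound for the distance of their points. -/
theorem sq_form_ge_of_ultraparallel (symm : ∀ u v, B u v = B v u)
    (lor : ∀ u w, B u u < 0 → B u u * B w w ≤ B u w ^ 2) {x x' β β' : V} (hx : B x x < 0)
    (hx' : B x' x' < 0) (hβ : B β β = 1) (hβ' : B β' β' = 1) (hxβ : B β x = 0)
    (hxβ' : B β' x' = 0) : B β β' ^ 2 * (B x x * B x' x') ≤ B x x' ^ 2 := by
  -- This bounds the distance from `x` to the line of `β'`; `h3` compares `x'` with the orthogonal
  -- projection of `x` to that line.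
  have h1 := lor x (β' - B β β' • β) hx
  have h2 : B (x - B β' x • β') (x - B β' x • β') = B x x - B β' x ^ 2 := by
    simp only [map_sub, map_smul, LinearMap.sub_apply, LinearMap.smul_apply, smul_eq_mul, hβ',
      symm x β']
    ring
  have h3 := lor (x - B β' x • β') x' (by rw [h2]; nlinarith [sq_nonneg (B β' x)])
  rw [h2] at h3
  simp only [map_sub, map_smul, LinearMap.sub_apply, LinearMap.smul_apply, smul_eq_mul, hβ, hβ',
    symm x β', symm x β, symm β' β, hxβ, hxβ'] at h1 h3
  nlinarith

end Lorentz

/-! ### Triangle data -/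

/-- The root datum of a hyperbolic triangle group without angle `π / 2`. -/
structure TriangleDatum (V : Type*) [AddCommGroup V] [Module ℝ V] extends
    RootDatum (Fin 3) V where
  three_le : ∀ i j, i ≠ j → 3 ≤ m i j
  four_le : ∀ a b c, a ≠ b → b ≠ c → a ≠ c → 4 ≤ m a b ∨ 4 ≤ m b c ∨ 4 ≤ m a c
  lorentz : ∀ u w, B u u < 0 → B u u * B w w ≤ B u w ^ 2
  span : ∀ v, ∃ c : Fin 3 → ℝ, v = ∑ i, c i • α i
  /-- the vertices -/
  vtx : Fin 3 → V
  vtx_norm : ∀ k, B (vtx k) (vtx k) = -1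
  vtx_orthogonal : ∀ i k, i ≠ k → B (α i) (vtx k) = 0
  vtx_pos : ∀ k, 0 < B (α k) (vtx k)

namespace TriangleDatum

variable {V : Type*} [AddCommGroup V] [Module ℝ V] (D : TriangleDatum V)

theorem half_le_cos {m : ℕ} (hm : 3 ≤ m) : 1 / 2 ≤ Real.cos (Real.pi / m) := by
  rw [← Real.cos_pi_div_three]
  have h : (3 : ℝ) ≤ m := by exact_mod_cast hm
  have := Real.pi_pos
  apply Real.cos_le_cos_of_nonneg_of_le_pi (by positivity) (by linarith)
  gcongr

theorem seven_tenths_le_cos {m : ℕ} (hm : 4 ≤ m) : 7 / 10 ≤ Real.cos (Real.pi / m) := by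
  have h2 : (7 / 10 : ℝ) ≤ √2 / 2 := by
    have : (7 / 5 : ℝ) ≤ √2 := Real.le_sqrt_of_sq_le (by norm_num)
    linarith
  refine h2.trans ?_
  rw [← Real.cos_pi_div_four]
  have h : (4 : ℝ) ≤ m := by exact_mod_cast hm
  have := Real.pi_pos
  apply Real.cos_le_cos_of_nonneg_of_le_pi (by positivity) (by linarith)
  gcongr

/-- The extreme case is the triangle (3, 3, 4), with 7/10 in place of √2/2: both 7/10 + 2·(1/4) and
1/2 + 2·(7/20) equal 6/5. -/
theorem six_fifths_le {a b c : Fin 3} (hab : a ≠ b) (hbc : b ≠ c) (hac : a ≠ c) :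
    6 / 5 ≤ Real.cos (Real.pi / D.m a c) +
      2 * (Real.cos (Real.pi / D.m a b) * Real.cos (Real.pi / D.m b c)) := by
  have h1 := half_le_cos (D.three_le a b hab)
  have h2 := half_le_cos (D.three_le b c hbc)
  have h3 := half_le_cos (D.three_le a c hac)
  rcases D.four_le a b c hab hbc hac with h | h | h <;>
  · have := seven_tenths_le_cos h
    nlinarith

/-- The right-hand side is minus the Gram determinant of the three simple roots; it stays away from
the Euclidean value 0 because one of the angles is at most π/4 and the others at most π/3. -/
theorem quarter_le {a b c : Fin 3} (hab : a ≠ b) (hbc : b ≠ c) (hac : a ≠ c) :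
    1 / 4 ≤ Real.cos (Real.pi / D.m a c) ^ 2 + Real.cos (Real.pi / D.m a b) ^ 2 +
      Real.cos (Real.pi / D.m b c) ^ 2 + 2 * (Real.cos (Real.pi / D.m a c) *
      (Real.cos (Real.pi / D.m a b) * Real.cos (Real.pi / D.m b c))) - 1 := by
  have h0 := D.six_fifths_le hab hbc hac
  have h1 := half_le_cos (D.three_le a b hab)
  have h2 := half_le_cos (D.three_le b c hbc)
  have h3 := half_le_cos (D.three_le a c hac)
  set A := Real.cos (Real.pi / D.m a c)
  set C := Real.cos (Real.pi / D.m a b)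
  set E := Real.cos (Real.pi / D.m b c)
  have h4 : C * E * (1 / 2) ≤ C * E * A := by
    apply mul_le_mul_of_nonneg_left h3; positivity
  rcases D.four_le a b c hab hbc hac with h | h | h <;>
  · have := seven_tenths_le_cos h
    nlinarith

theorem exists_combo {a b k : Fin 3} (hab : a ≠ b) (hbk : b ≠ k) (hak : a ≠ k) (v : V) :
    ∃ x y z : ℝ, v = x • D.α a + y • D.α b + z • D.α k := by
  obtain ⟨c, hc⟩ := D.span v
  have hu : (Finset.univ : Finset (Fin 3)) = {a, b, k} := by
    revert a b k; decide
  refine ⟨c a, c b, c k, ?_⟩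
  rw [hc, hu, Finset.sum_insert (by simp [hab, hak]), Finset.sum_insert (by simp [hbk]),
    Finset.sum_singleton, add_assoc]

/-- The right-hand side equals minus the Gram determinant. Since π / m a b is the angle at `vtx k`,
a vertex with a small angle is far from the opposite side. -/
theorem altitude {a b k : Fin 3} (hab : a ≠ b) (hbk : b ≠ k) (hak : a ≠ k) :
    1 / 4 ≤ D.B (D.α k) (D.vtx k) ^ 2 * Real.sin (Real.pi / D.m a b) ^ 2 := by
  obtain ⟨x, y, z, hv⟩ := D.exists_combo hab hbk hak (D.vtx k)
  have h1 := D.vtx_orthogonal a k hak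
  have h2 := D.vtx_orthogonal b k hbk
  have h4 := D.vtx_norm k
  set h := D.B (D.α k) (D.vtx k) with h3
  have h5 : z * h = -1 := by
    have := congrArg (fun u => D.B u (D.vtx k)) hv
    simp only [map_add, map_smul, LinearMap.add_apply, LinearMap.smul_apply, smul_eq_mul, h1, h2,
      ← h3, h4] at this
    linarith
  have h3' : h = D.B (D.α k) (x • D.α a + y • D.α b + z • D.α k) := by rw [← hv]
  clear_value h
  rw [hv] at h1 h2
  simp only [map_add, map_smul, smul_eq_mul, D.norm, D.gram _ _ hab, D.gram _ _ hbk,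
    D.gram _ _ hak, D.symm (D.α b) (D.α a), D.symm (D.α k) (D.α a),
    D.symm (D.α k) (D.α b)] at h1 h2 h3'
  rw [Real.sin_sq]
  have hq := D.quarter_le hab hbk hak
  set A := Real.cos (Real.pi / D.m a k)
  set C := Real.cos (Real.pi / D.m a b)
  set E := Real.cos (Real.pi / D.m b k)
  have : h ^ 2 * (1 - C ^ 2) = A ^ 2 + C ^ 2 + E ^ 2 + 2 * (A * (C * E)) - 1 := by
    linear_combination h * (1 - C ^ 2) * h3' - h * (A + E * C) * h1 - h * (E + C * A) * h2 +
      (1 - C ^ 2 - A ^ 2 - E ^ 2 - 2 * A * C * E) * h5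
  linarith

/-- Jordan's inequality for Kθ and sin θ ≤ θ eliminate h, g and θ and leave K² ≤ 2π²κ; the constant
20 comes from π² ≤ 10. -/
theorem sq_le_of_sin_bounds {K : ℕ} {θ h g κ : ℝ} (hθpos : 0 < θ) (hspos : 0 < Real.sin θ)
    (hK : K * θ ≤ Real.pi / 2) (halt : 1 / 4 ≤ h ^ 2 * Real.sin θ ^ 2)
    (hS4 : Real.sin (K * θ) ^ 2 * (1 + g ^ 2) ≤ 4) (hκ : 2 * h ^ 2 ≤ κ * (1 + g ^ 2)) :
    (K : ℝ) ^ 2 ≤ 20 * κ := by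
  have hsinK : 2 / Real.pi * (K * θ) ≤ Real.sin (K * θ) :=
    Real.mul_le_sin (by positivity) hK
  have hsinθ : Real.sin θ ≤ θ := Real.sin_le hθpos.le
  have e1 : 1 / 4 ≤ h ^ 2 * θ ^ 2 := halt.trans (by gcongr)
  have e2 : (2 / Real.pi * (K * θ)) ^ 2 ≤ Real.sin (K * θ) ^ 2 := by gcongr
  have hκ0 : 0 ≤ κ := by
    by_contra hlt
    nlinarith [sq_nonneg h, sq_nonneg g]
  have e3 : (2 / Real.pi * (K * θ)) ^ 2 * (2 * h ^ 2) ≤ 4 * κ := by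
    calc (2 / Real.pi * (K * θ)) ^ 2 * (2 * h ^ 2)
        ≤ Real.sin (K * θ) ^ 2 * (κ * (1 + g ^ 2)) := by gcongr
      _ = κ * (Real.sin (K * θ) ^ 2 * (1 + g ^ 2)) := by ring
      _ ≤ κ * 4 := by gcongr
      _ = 4 * κ := by ring
  have hpi : Real.pi ^ 2 ≤ 10 := by nlinarith [Real.pi_pos, Real.pi_lt_d2]
  have e4 : (2 / Real.pi * (K * θ)) ^ 2 * (2 * h ^ 2) * Real.pi ^ 2 = 8 * K ^ 2 * (h ^ 2 * θ ^ 2) := by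
    field_simp; ring
  have e5 : 8 * (K : ℝ) ^ 2 * (1 / 4) ≤ 8 * K ^ 2 * (h ^ 2 * θ ^ 2) := by gcongr
  nlinarith [mul_le_mul e3 hpi (sq_nonneg _) (by positivity)]

/-- A line that meets two walls through a vertex, which include a large angle, is close to the
vertex; if it is the axis of a translation that moves the vertex a lot, then the translation length
is large. -/
theorem run_bound {a b k : Fin 3} (hab : a ≠ b) (hbk : b ≠ k) (hak : a ≠ k) {K : ℕ} {n : V} {κ : ℝ}
    (hn : D.B n n = 1) (hK : K * (Real.pi / D.m a b) ≤ Real.pi / 2)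
    (h0 : D.B n (D.α a) ^ 2 ≤ 1)
    (h1 : D.B n (D.wp (RootDatum.alt a b K) (D.α (RootDatum.nxt a b K))) ^ 2 ≤ 1)
    (hκ : 2 * D.B (D.α k) (D.vtx k) ^ 2 ≤ κ * (1 + D.B (D.vtx k) n ^ 2)) : (K : ℝ) ^ 2 ≤ 20 * κ := by
  have halt := D.altitude hab hbk hak
  have hwp := D.sin_smul_wp_alt hab (D.gram a b hab) K
  have hspos := D.sin_pos hab
  have hθpos : 0 < Real.pi / D.m a b := by
    have : (3 : ℝ) ≤ D.m a b := by exact_mod_cast D.three_le a b hab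
    have := Real.pi_pos
    positivity
  set θ := Real.pi / D.m a b with hθ
  set ρ := D.wp (RootDatum.alt a b K) (D.α (RootDatum.nxt a b K))
  set g := D.B (D.vtx k) n with hg
  -- `n + g • vtx k` is the projection of `n` to the complement of the vertex, which is the plane of
  -- `α a` and `α b`; its square is 1 + g².
  obtain ⟨x, y, z, hv⟩ := D.exists_combo hab hbk hak (n + g • D.vtx k)
  have hz : z = 0 := by
    have h : D.B (n + g • D.vtx k) (D.vtx k) = 0 := by
      simp only [map_add, map_smul, LinearMap.add_apply, LinearMap.smul_apply, smul_eq_mul,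
        D.vtx_norm, D.symm n, ← hg]; ring
    rw [hv] at h
    simp only [map_add, map_smul, LinearMap.add_apply, LinearMap.smul_apply, smul_eq_mul,
      D.vtx_orthogonal a k hak, D.vtx_orthogonal b k hbk, mul_zero, zero_add] at h
    exact (mul_eq_zero.1 h).resolve_right (D.vtx_pos k).ne'
  rw [hz, zero_smul, add_zero] at hv
  have hga := D.gram a b hab
  have hgb : D.B (D.α b) (D.α a) = -Real.cos θ := by rw [D.symm]; exact hga
  have hp : D.B n (D.α a) = x - Real.cos θ * y := by
    have : n = x • D.α a + y • D.α b - g • D.vtx k := by rw [← hv]; abel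
    rw [this]
    simp only [map_add, map_sub, map_smul, LinearMap.add_apply, LinearMap.sub_apply,
      LinearMap.smul_apply, smul_eq_mul, D.symm (D.vtx k), D.vtx_orthogonal a k hak, D.norm, hgb]
    ring
  have hr : D.B n (D.α b) = y - Real.cos θ * x := by
    have : n = x • D.α a + y • D.α b - g • D.vtx k := by rw [← hv]; abel
    rw [this]
    simp only [map_add, map_sub, map_smul, LinearMap.add_apply, LinearMap.sub_apply,
      LinearMap.smul_apply, smul_eq_mul, D.symm (D.vtx k), D.vtx_orthogonal b k hbk, D.norm, hga]
    rw [← hθ]; ring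
  have hνν : 1 + g ^ 2 = x ^ 2 + y ^ 2 - 2 * Real.cos θ * x * y := by
    have h : D.B (n + g • D.vtx k) (n + g • D.vtx k) = 1 + g ^ 2 := by
      simp only [map_add, map_smul, LinearMap.add_apply, LinearMap.smul_apply, smul_eq_mul,
        D.vtx_norm, D.symm n (D.vtx k), ← hg, hn]; ring
    rw [← h, hv]
    simp only [map_add, map_smul, LinearMap.add_apply, LinearMap.smul_apply, smul_eq_mul,
      D.norm, hga, hgb, ← hθ]
    ring
  have hq : D.B n ρ = Real.sin (K * θ) * Real.sin θ * y + Real.cos (K * θ) * D.B n (D.α a) := by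
    have h := congrArg (D.B n) hwp
    simp only [map_add, map_smul, smul_eq_mul] at h
    rw [add_mul, one_mul, Real.sin_add, hr, hp] at h
    rw [hp]
    apply mul_left_cancel₀ hspos.ne'
    linear_combination h - Real.sin (K * θ) * y * Real.sin_sq_add_cos_sq θ
  set p := D.B n (D.α a)
  set q := D.B n ρ
  -- In this Euclidean plane p and q are the products with two unit vectors at angle Kθ, and these
  -- determine the length of the projection.
  have hS : Real.sin (K * θ) ^ 2 * (1 + g ^ 2) = p ^ 2 + q ^ 2 - 2 * Real.cos (K * θ) * p * q := by
    rw [hq, hνν, hp]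
    linear_combination (x - Real.cos θ * y) ^ 2 * Real.sin_sq_add_cos_sq (K * θ) -
      Real.sin (K * θ) ^ 2 * y ^ 2 * Real.sin_sq_add_cos_sq θ
  have hS4 : Real.sin (K * θ) ^ 2 * (1 + g ^ 2) ≤ 4 := by
    have hc := Real.cos_sq_le_one (K * θ)
    have : (Real.cos (K * θ) * p) ^ 2 ≤ 1 := by
      rw [mul_pow]; exact mul_le_one₀ hc (sq_nonneg _) h0
    rw [hS]; nlinarith [sq_nonneg (Real.cos (K * θ) * p + q)]
  exact sq_le_of_sin_bounds hθpos hspos hK halt hS4 hκ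

end TriangleDatum

/-! ### The bound for the word length -/

namespace TriangleDatum

variable {V : Type*} [AddCommGroup V] [Module ℝ V] (D : TriangleDatum V)

/-- The hyperplanes of the first and the third of three walls, crossed consecutively by a gallery
with pairwise distinct letters, are ultraparallel. -/
theorem six_fifths_le_form {a b c : Fin 3} (hab : a ≠ b) (hbc : b ≠ c) (hac : a ≠ c) :
    6 / 5 ≤ D.B (D.α a) (D.refl a (D.refl b (D.α c))) := by
  rw [← RootDatum.form_refl_left, RootDatum.refl_root, RootDatum.refl_apply, map_neg,
    LinearMap.neg_apply, map_sub, map_smul, smul_eq_mul, D.gram _ _ hab, D.gram _ _ hbc,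
    D.gram _ _ hac]
  have := D.six_fifths_le hab hbc hac
  linarith

theorem alternates {w : ℕ → Fin 3} {j L : ℕ} (h : ∀ e, e + 2 < L → w (j + e + 2) = w (j + e)) :
    ∀ e, e < L → w (j + e) = RootDatum.nxt (w j) (w (j + 1)) e := by
  intro e
  induction e using Nat.strong_induction_on with
  | _ e ih =>
    intro he
    match e with
    | 0 => simp
    | 1 => simp [RootDatum.nxt_succ]
    | e + 2 =>
      rw [RootDatum.nxt_succ, RootDatum.nxt_succ, ← ih e (by omega) (by omega), ← h e he, add_assoc]

theorem exists_third {a b : Fin 3} (h : a ≠ b) : ∃ k, b ≠ k ∧ a ≠ k := by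
  revert a b; decide

/-- A bound for the length of a group element that acts as a translation whose axis meets the
chamber. -/
theorem len_le {κ : ℝ} (hκ : 0 < κ) {l : List (Fin 3)} {x n : V} (hx : x ∈ D.chamber)
    (hxx : D.B x x = -1) (hn : D.B n n = 1) (hxn : D.B n x = 0) (hyn : D.B n (D.wp l x) = 0)
    (hxy : D.B x (D.wp l x) = -1 - κ)
    (hdisp : ∀ k r, D.B (D.wp r (D.vtx k)) (D.wp l (D.wp r (D.vtx k))) =
      -1 - κ * (1 + D.B (D.wp r (D.vtx k)) n ^ 2))
    {C N : ℕ} (hC : 20 * κ < C ^ 2) (hN : 2 * (1 + κ) < N) : D.len (D.wp l) ≤ N * (2 * C + 1) := by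
  obtain ⟨w, t, hw, htm, ht, hB⟩ := D.exists_gallery _ l rfl x x hx hx
  set y := D.wp l x with hy
  set m := D.len (D.wp l) with hm
  have hyy : D.B y y = -1 := by rw [hy, RootDatum.form_wp_wp, hxx]
  have hyx : D.B y x = -1 - κ := by rw [D.symm, hxy]
  have hred : D.len (D.pw w m) = m := by rw [hw]
  set X : ℕ → V := fun j => (1 - t j) • x + t j • y with hX
  set β : ℕ → V := fun j => D.pw w j (D.α (w j)) with hβ
  have hXX : ∀ j, D.B (X j) (X j) ≤ -1 := fun j => by
    have := ht j
    simp only [hX, map_add, map_smul, LinearMap.add_apply, LinearMap.smul_apply, smul_eq_mul, hxx,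
      hxy, hyy, hyx]
    nlinarith [mul_nonneg this.1 (sub_nonneg.2 this.2), mul_nonneg (mul_nonneg this.1
      (sub_nonneg.2 this.2)) hκ.le]
  have hnX : ∀ j, D.B n (X j) = 0 := fun j => by simp [hX, hxn, hyn]
  have hββ : ∀ j, D.B (β j) (β j) = 1 := fun j => by
    simp only [hβ, RootDatum.pw, RootDatum.form_wp_wp, D.norm]
  have hnβ : ∀ j, j < m → D.B n (β j) ^ 2 ≤ 1 := fun j hj =>
    sq_form_le_one D.symm D.lorentz (by linarith [hXX j]) hn (hββ j) (hnX j) (hB j hj)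
  -- time between walls without common vertex
  have hgap : ∀ j, j + 2 < m → w (j + 2) ≠ w j → 1 ≤ (t (j + 2) - t j) * (2 * (1 + κ)) := by
    intro j hj hne
    have h1 := D.ne_succ_of_reduced hred (show j + 1 < m by omega)
    have h2 := D.ne_succ_of_reduced hred (show j + 1 + 1 < m by omega)
    have h3 : 6 / 5 ≤ D.B (β j) (β (j + 2)) := by
      simp only [hβ, RootDatum.pw_succ, Module.End.mul_apply]
      rw [RootDatum.pw, RootDatum.form_wp_wp]
      exact D.six_fifths_le_form h1 h2 hne.symm
    have h4 := sq_form_ge_of_ultraparallel D.symm D.lorentz (by linarith [hXX j])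
      (by linarith [hXX (j + 2)]) (hββ j) (hββ (j + 2)) (hB j (by omega)) (hB (j + 2) hj)
    -- The Gram determinant of two points of the chord scales with the square of the parameter
    -- difference.
    have h5 : D.B (X j) (X (j + 2)) ^ 2 = D.B (X j) (X j) * D.B (X (j + 2)) (X (j + 2)) +
        (t (j + 2) - t j) ^ 2 * ((1 + κ) ^ 2 - 1) := by
      simp only [hX, map_add, map_smul, LinearMap.add_apply, LinearMap.smul_apply, smul_eq_mul, hxx,
        hxy, hyy, hyx]
      ring
    have h6 : 1 ≤ D.B (X j) (X j) * D.B (X (j + 2)) (X (j + 2)) := by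
      nlinarith [hXX j, hXX (j + 2)]
    have h7 : (36 / 25 : ℝ) ≤ D.B (β j) (β (j + 2)) ^ 2 := by nlinarith
    have h8 := htm (show j ≤ j + 2 by omega)
    -- 11/25 = (6/5)² - 1; multiplied by 4 it exceeds 1, whence the factor 2 in the claim.
    have h9 : 11 / 25 ≤ (t (j + 2) - t j) ^ 2 * ((1 + κ) ^ 2 - 1) := by nlinarith
    refine (one_le_sq_iff₀ (mul_nonneg (by linarith) (by linarith))).1 ?_
    nlinarith [sq_nonneg (t (j + 2) - t j)]
  -- a long window contains three walls without common vertex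
  have hwin : ∀ j, j + (2 * C + 1) < m → 1 ≤ (t (j + (2 * C + 1)) - t j) * (2 * (1 + κ)) := by
    intro j hj
    have hC1 : 1 ≤ C := by
      rcases Nat.eq_zero_or_pos C with rfl | h
      · norm_num at hC; linarith
      · exact h
    by_cases hex : ∃ e, e + 2 < 2 * C + 2 ∧ w (j + e + 2) ≠ w (j + e)
    · obtain ⟨e, he, hne⟩ := hex
      have h1 := hgap (j + e) (by omega) hne
      have h2 := htm (show j ≤ j + e by omega)
      have h3 := htm (show j + e + 2 ≤ j + (2 * C + 1) by omega)
      refine h1.trans ?_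
      gcongr
    exfalso
    push Not at hex
    have hab := D.ne_succ_of_reduced hred (show j + 1 < m by omega)
    have halt := alternates hex
    obtain ⟨k, hbk, hak⟩ := exists_third hab
    -- The run has 2C + 2 letters, so m ≥ 2C + 2, and the walls numbered j and j + C through the
    -- vertex include an angle of at most π/2.
    have hle := D.le_m_of_reduced hred hab halt (by omega)
    have hm3 : (0 : ℝ) < D.m (w j) (w (j + 1)) := by
      exact_mod_cast (show 0 < D.m (w j) (w (j + 1)) by omega)
    set lj := (List.range j).map w with hlj
    have hval : ∀ v, D.B (D.wp lj.reverse n) v = D.B n (D.wp lj v) := fun v => by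
      rw [RootDatum.form_wp_left, List.reverse_reverse]
    have hbd := D.run_bound hab hbk hak (K := C) (n := D.wp lj.reverse n) (κ := κ)
      (by rw [RootDatum.form_wp_wp, hn]) ?_ ?_ ?_ ?_
    · linarith
    · have : (2 * C : ℝ) ≤ D.m (w j) (w (j + 1)) := by
        exact_mod_cast (show 2 * C ≤ D.m (w j) (w (j + 1)) by omega)
      rw [mul_div_assoc', div_le_div_iff₀ hm3 two_pos]
      nlinarith [Real.pi_pos]
    · rw [hval]; exact hnβ j (by omega)
    · rw [hval, ← Module.End.mul_apply]
      have h1 := D.pw_add_alt (K := C) fun e he => halt e (by omega)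
      have h2 := hnβ (j + C) (by omega)
      simp only [hβ] at h2
      rwa [h1, halt C (by omega)] at h2
    -- The common vertex of the run is `wp lj (vtx k)`. Its displacement, known from its position
    -- relative to the axis, is positive and so at least twice the altitude.
    · have h1 := hdisp k lj
      have h2 : D.B (D.vtx k) (D.wp (lj.reverse ++ (l ++ lj)) (D.vtx k)) =
          D.B (D.wp lj (D.vtx k)) (D.wp l (D.wp lj (D.vtx k))) := by
        rw [RootDatum.form_wp_left, RootDatum.wp_append, RootDatum.wp_append]; rfl
      have h3 : 0 < κ * (1 + D.B (D.wp lj (D.vtx k)) n ^ 2) := by positivity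
      have h4 := D.form_vertex_le (D.vtx_norm k) (D.vtx_pos k).le
        (fun i hi => D.vtx_orthogonal i k hi) (lj.reverse ++ (l ++ lj)) (by rw [h2, h1]; linarith)
      rw [h2, h1] at h4
      rw [← RootDatum.form_wp_left]
      linarith
  have hsteps : ∀ i : ℕ, i * (2 * C + 1) < m → (i : ℝ) ≤ t (i * (2 * C + 1)) * (2 * (1 + κ)) := by
    intro i
    induction i with
    | zero => intro _; simpa using mul_nonneg (ht 0).1 (by linarith)
    | succ i ih =>
      intro hi
      have e : (i + 1) * (2 * C + 1) = i * (2 * C + 1) + (2 * C + 1) := by ring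
      rw [e] at hi ⊢
      have h1 := ih (by omega)
      have h2 := hwin _ hi
      push_cast
      linarith
  by_contra hlt
  -- The parameter never exceeds 1, so N full windows would give N ≤ 2(1 + κ).
  have h1 := hsteps N (by omega)
  have h2 := (ht (N * (2 * C + 1))).2
  nlinarith

end TriangleDatum

/-! ### The hyperboloid model -/

/-- The Minkowski form on `ℝ³`. -/
noncomputable def mink : LinearMap.BilinForm ℝ (ℝ × ℝ × ℝ) :=
  LinearMap.mk₂ ℝ (fun u v => -(u.1 * v.1) + u.2.1 * v.2.1 + u.2.2 * v.2.2)
    (fun _ _ _ => by simp; ring) (fun _ _ _ => by simp; ring) (fun _ _ _ => by simp; ring)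
    (fun _ _ _ => by simp; ring)

theorem mink_apply (u v : ℝ × ℝ × ℝ) :
    mink u v = -(u.1 * v.1) + u.2.1 * v.2.1 + u.2.2 * v.2.2 := rfl

theorem mink_symm (u v : ℝ × ℝ × ℝ) : mink u v = mink v u := by
  simp only [mink_apply]; ring

/-- The reversed Cauchy–Schwarz inequality. By Lagrange's identity it says that the spatial 2 × 2
minor is dominated by the two mixed ones (`h4`). -/
theorem mink_lorentz (u w : ℝ × ℝ × ℝ) (hu : mink u u < 0) :
    mink u u * mink w w ≤ mink u w ^ 2 := by
  simp only [mink_apply] at *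
  obtain ⟨u1, u2, u3⟩ := u
  obtain ⟨w1, w2, w3⟩ := w
  simp only at *
  have h1 : (u1 * (u2 * w3 - u3 * w2)) ^ 2 ≤
      (u2 ^ 2 + u3 ^ 2) * ((u1 * w2 - w1 * u2) ^ 2 + (u1 * w3 - w1 * u3) ^ 2) := by
    nlinarith [sq_nonneg (u2 * (u1 * w2 - w1 * u2) + u3 * (u1 * w3 - w1 * u3))]
  have h2 : (u2 ^ 2 + u3 ^ 2) * ((u1 * w2 - w1 * u2) ^ 2 + (u1 * w3 - w1 * u3) ^ 2) ≤
      u1 ^ 2 * ((u1 * w2 - w1 * u2) ^ 2 + (u1 * w3 - w1 * u3) ^ 2) := by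
    apply mul_le_mul_of_nonneg_right (by linarith) (by positivity)
  have h3 : 0 < u1 ^ 2 := by nlinarith [sq_nonneg u2, sq_nonneg u3]
  have h4 : (u2 * w3 - u3 * w2) ^ 2 ≤ (u1 * w2 - w1 * u2) ^ 2 + (u1 * w3 - w1 * u3) ^ 2 := by
    rw [mul_pow] at h1
    exact le_of_mul_le_mul_left (h1.trans h2) h3
  nlinarith

/-- The point of the hyperboloid that corresponds to a point of the upper half-plane. -/
noncomputable def vec (z : ℍ) : ℝ × ℝ × ℝ :=
  ((z.re ^ 2 + z.im ^ 2 + 1) / (2 * z.im), (z.re ^ 2 + z.im ^ 2 - 1) / (2 * z.im), z.re / z.im)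

theorem mink_vec (z w : ℍ) : mink (vec z) (vec w) = -Real.cosh (dist z w) := by
  have h1 := z.im_pos
  have h2 := w.im_pos
  rw [UpperHalfPlane.cosh_dist, Complex.dist_eq, Complex.sq_norm, Complex.normSq_apply, mink_apply,
    vec, vec]
  simp only [Complex.sub_re, Complex.sub_im, UpperHalfPlane.coe_re, UpperHalfPlane.coe_im]
  field_simp
  ring

theorem mink_vec_self (z : ℍ) : mink (vec z) (vec z) = -1 := by simp [mink_vec]

theorem vec_fst_pos (z : ℍ) : 0 < (vec z).1 := by
  have := z.im_pos
  simp only [vec]; positivity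

theorem dist_eq_iff_mink {a b c d : ℍ} :
    dist a b = dist c d ↔ mink (vec a) (vec b) = mink (vec c) (vec d) := by
  rw [mink_vec, mink_vec, neg_inj]
  exact ⟨fun h => by rw [h], fun h => by
    have := congrArg Real.arcosh h
    rwa [Real.arcosh_cosh dist_nonneg, Real.arcosh_cosh dist_nonneg] at this⟩

theorem vec_injective : Function.Injective vec := fun z w h => by
  rw [← dist_eq_zero, ← dist_self w, dist_eq_iff_mink, h]

theorem exists_vec_eq {v : ℝ × ℝ × ℝ} (hv : mink v v = -1) (h0 : 0 < v.1) : ∃ z : ℍ, vec z = v := by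
  obtain ⟨a, b, c⟩ := v
  simp only [mink_apply] at *
  have h1 : 0 < a - b := by nlinarith [sq_nonneg c]
  -- In `vec z` the difference of the first two coordinates is 1 / Im z, and the third is Re z / Im
  -- z.
  refine ⟨⟨⟨c / (a - b), 1 / (a - b)⟩, by simpa using h1⟩, ?_⟩
  have h2 : (a - b) * (a + b) = c ^ 2 + 1 := by linarith
  simp only [vec, UpperHalfPlane.re, UpperHalfPlane.im, Prod.mk.injEq]
  refine ⟨?_, ?_, ?_⟩
  · field_simp; linarith
  · field_simp; linarith
  · field_simp

theorem fst_pos_of_mink_neg {u v : ℝ × ℝ × ℝ} (hu : mink u u = -1) (hv : mink v v = -1)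
    (h0 : 0 < u.1) (h : mink u v < 0) : 0 < v.1 := by
  obtain ⟨a, b, c⟩ := u
  obtain ⟨a', b', c'⟩ := v
  simp only [mink_apply] at *
  by_contra hneg
  have h1 : 0 ≤ a * (-a') := mul_nonneg h0.le (by linarith)
  have h2 : b * b' + c * c' < -(a * (-a')) := by linarith
  have h3 : (a * (-a')) ^ 2 < (b * b' + c * c') ^ 2 := by nlinarith
  have h4 : (b * b' + c * c') ^ 2 ≤ (b ^ 2 + c ^ 2) * (b' ^ 2 + c' ^ 2) := by
    nlinarith [sq_nonneg (b * c' - c * b')]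
  have h5 : b ^ 2 + c ^ 2 = a ^ 2 - 1 := by linarith
  have h6 : b' ^ 2 + c' ^ 2 = a' ^ 2 - 1 := by linarith
  rw [h5, h6] at h4
  nlinarith [sq_nonneg b, sq_nonneg c, sq_nonneg b', sq_nonneg c']

/-- Two points of the hyperboloid have product at most `-1`. -/
theorem mink_vec_le (z w : ℍ) : mink (vec z) (vec w) ≤ -1 := by
  rw [mink_vec]; linarith [Real.one_le_cosh (dist z w)]

/-- Reflection of `ℝ³` in the plane orthogonal to `α`. -/
noncomputable def mrefl (α v : ℝ × ℝ × ℝ) : ℝ × ℝ × ℝ := v - (2 * mink α v) • α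

theorem mink_mrefl {α : ℝ × ℝ × ℝ} (hα : mink α α = 1) (u v : ℝ × ℝ × ℝ) :
    mink (mrefl α u) (mrefl α v) = mink u v := by
  simp only [mrefl, map_sub, map_smul, LinearMap.sub_apply, LinearMap.smul_apply, smul_eq_mul, hα,
    mink_symm u α]
  ring

theorem mrefl_mrefl {α : ℝ × ℝ × ℝ} (hα : mink α α = 1) (v : ℝ × ℝ × ℝ) :
    mrefl α (mrefl α v) = v := by
  simp only [mrefl, map_sub, map_smul, smul_eq_mul, hα]
  module

theorem exists_vec_mrefl {α : ℝ × ℝ × ℝ} (hα : mink α α = 1) (z : ℍ) :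
    ∃ w : ℍ, vec w = mrefl α (vec z) := by
  have h : mink (mrefl α (vec z)) (mrefl α (vec z)) = -1 := by rw [mink_mrefl hα, mink_vec_self]
  refine exists_vec_eq h (fst_pos_of_mink_neg (mink_vec_self z) h (vec_fst_pos z) ?_)
  simp only [mrefl, map_sub, map_smul, smul_eq_mul, mink_vec_self, mink_symm (vec z) α]
  nlinarith [sq_nonneg (mink α (vec z))]

/-- The reflection of the hyperbolic plane in the line orthogonal to `α`. -/
theorem exists_isometry_mrefl {α : ℝ × ℝ × ℝ} (hα : mink α α = 1) :
    ∃ σ : ℍ ≃ᵢ ℍ, ∀ z, vec (σ z) = mrefl α (vec z) := by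
  choose f hf using exists_vec_mrefl hα
  have hinv : ∀ z, f (f z) = z := fun z => vec_injective (by rw [hf, hf, mrefl_mrefl hα])
  refine ⟨⟨⟨f, f, hinv, hinv⟩, Isometry.of_dist_eq fun z w => ?_⟩, hf⟩
  rw [dist_eq_iff_mink]
  exact (by rw [hf, hf, mink_mrefl hα] : mink (vec (f z)) (vec (f w)) = mink (vec z) (vec w))

/-! ### Cross products -/

/-- The Minkowski cross product. -/
def cross (a b : ℝ × ℝ × ℝ) : ℝ × ℝ × ℝ :=
  (-(a.2.1 * b.2.2 - a.2.2 * b.2.1), a.2.2 * b.1 - a.1 * b.2.2, a.1 * b.2.1 - a.2.1 * b.1)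

theorem mink_cross_cross (a b c d : ℝ × ℝ × ℝ) : mink (cross a b) (cross c d) =
    mink a d * mink b c - mink a c * mink b d := by
  simp only [cross, mink_apply]; ring

theorem mink_cross_left (a b : ℝ × ℝ × ℝ) : mink (cross a b) a = 0 := by
  simp only [cross, mink_apply]; ring

theorem mink_cross_right (a b : ℝ × ℝ × ℝ) : mink (cross a b) b = 0 := by
  simp only [cross, mink_apply]; ring

theorem mink_cross_rotate (a b c : ℝ × ℝ × ℝ) : mink (cross a b) c = mink (cross b c) a := by
  simp only [cross, mink_apply]; ring

/-- The square of the determinant is minus the Gram determinant. -/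
theorem mink_cross_sq (a b c : ℝ × ℝ × ℝ) : mink (cross a b) c ^ 2 =
    -(mink a a * (mink b b * mink c c - mink b c ^ 2) -
      mink a b * (mink a b * mink c c - mink b c * mink a c) +
      mink a c * (mink a b * mink b c - mink b b * mink a c)) := by
  simp only [cross, mink_apply]; ring

/-- Vectors orthogonal to a basis vanish. -/
theorem eq_zero_of_orthogonal {a b c v : ℝ × ℝ × ℝ} (hd : mink (cross a b) c ≠ 0)
    (ha : mink v a = 0) (hb : mink v b = 0) (hc : mink v c = 0) : v = 0 := by
  have key : mink (cross a b) c • v =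
      mink v a • cross b c + mink v b • cross c a + mink v c • cross a b := by
    obtain ⟨v1, v2, v3⟩ := v
    ext <;> simp [cross, mink_apply] <;> ring
  rw [ha, hb, hc] at key
  simpa [hd] using key

/-- The squared determinant is minus the Gram determinant, which vanishes when one of the three
distances is the sum of the other two. -/
theorem mink_cross_eq_zero_of_mem_line {a b x : ℍ} (hx : x ∈ line a b) :
    mink (cross (vec a) (vec b)) (vec x) = 0 := by
  have key : ∀ a b x : ℍ, dist a x + dist x b = dist a b →
      mink (cross (vec a) (vec b)) (vec x) ^ 2 = 0 := fun a b x h => by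
    rw [mink_cross_sq, mink_vec_self, mink_vec_self, mink_vec_self, mink_vec, mink_vec, mink_vec,
      ← h, Real.cosh_add, dist_comm x b]
    linear_combination (Real.cosh (dist b x) ^ 2 - 1) * Real.cosh_sq (dist a x) +
      Real.sinh (dist a x) ^ 2 * Real.cosh_sq (dist b x)
  rcases hx with h | h | h
  · exact pow_eq_zero_iff two_ne_zero |>.1 (key a b x h)
  · rw [mink_cross_rotate, mink_cross_rotate,
      show cross (vec x) (vec a) = cross (vec x) (vec a) from rfl]
    have h1 := pow_eq_zero_iff two_ne_zero |>.1 (key x b a h)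
    have h2 : mink (cross (vec x) (vec a)) (vec b) = -mink (cross (vec x) (vec b)) (vec a) := by
      simp only [cross, mink_apply]; ring
    rw [h2, h1, neg_zero]
  · have h1 := pow_eq_zero_iff two_ne_zero |>.1 (key a x b h)
    have h2 : mink (cross (vec a) (vec b)) (vec x) = -mink (cross (vec a) (vec x)) (vec b) := by
      simp only [cross, mink_apply]; ring
    rw [h2, h1, neg_zero]

theorem left_mem_line (a b : ℍ) : a ∈ line a b := .inl (by simp [segment])

theorem right_mem_line (a b : ℍ) : b ∈ line a b := .inl (by simp [segment])

/-- A nontrivial isometry that fixes two points is the reflection in the line through them. -/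
theorem vec_of_fixes {a b : ℍ} {α : ℝ × ℝ × ℝ} (hα : mink α α = 1)
    (hspan : ∀ v, mink v (vec a) = 0 → mink v (vec b) = 0 → ∃ k : ℝ, v = k • α)
    {σ : ℍ ≃ᵢ ℍ} (hσ : σ ≠ 1) (ha : σ a = a) (hb : σ b = b) (z : ℍ) :
    vec (σ z) = mrefl α (vec z) := by
  have hpres : ∀ x y, mink (vec (σ x)) (vec (σ y)) = mink (vec x) (vec y) := fun x y => by
    rw [← dist_eq_iff_mink, σ.dist_eq]
  have hor : ∀ z, vec (σ z) = vec z ∨ vec (σ z) = mrefl α (vec z) := fun z => by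
    have h1 := hpres z a
    have h2 := hpres z b
    rw [ha] at h1
    rw [hb] at h2
    obtain ⟨k, hk⟩ := hspan (vec (σ z) - vec z) (by simp [h1]) (by simp [h2])
    have h3 : vec (σ z) = vec z + k • α := by rw [← hk]; abel
    have h4 := hpres z z
    rw [h3] at h4
    simp only [map_add, map_smul, LinearMap.add_apply, LinearMap.smul_apply, smul_eq_mul, hα,
      mink_symm (vec z) α] at h4
    have h5 : k * (k + 2 * mink α (vec z)) = 0 := by linarith
    rcases mul_eq_zero.1 h5 with h6 | h6
    · left; rw [h3, h6]; simp
    · right; rw [h3, mrefl, show k = -(2 * mink α (vec z)) by linarith]; module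
  obtain ⟨z₀, hz₀⟩ : ∃ z₀, σ z₀ ≠ z₀ := by
    by_contra h
    push Not at h
    exact hσ (IsometryEquiv.ext h)
  have hz₀' := (hor z₀).resolve_left fun h => hz₀ (vec_injective h)
  refine (hor z).elim (fun h => ?_) id
  -- A fixed point keeps its distance to the moved point `z₀`, which forces it onto the mirror.
  have h1 := hpres z z₀
  rw [h, hz₀', mrefl] at h1
  simp only [map_sub, map_smul, smul_eq_mul, mink_symm (vec z) α] at h1
  have h2 : mink α (vec z₀) * mink α (vec z) = 0 := by linarith
  rcases mul_eq_zero.1 h2 with h3 | h3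
  · exact absurd (vec_injective (by rw [hz₀', mrefl, h3]; simp)) hz₀
  · rw [h, mrefl, h3]; simp

/-! ### Angles -/

theorem discCoord_eq_smul (z w : ℍ) : discCoord z w =
    (1 / ((w.re - z.re) ^ 2 + (w.im + z.im) ^ 2) : ℝ) •
      (⟨(w.re - z.re) ^ 2 + w.im ^ 2 - z.im ^ 2, -2 * z.im * (w.re - z.re)⟩ : ℂ) := by
  have h1 := z.im_pos
  have h2 := w.im_pos
  have h3 : 0 < (w.re - z.re) ^ 2 + (w.im + z.im) ^ 2 := by positivity
  have h4 : (w : ℂ) - star (z : ℂ) ≠ 0 := fun h => by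
    have := congrArg Complex.im h
    simp at this
    linarith
  rw [discCoord, div_eq_iff h4]
  rw [Complex.real_smul]
  apply Complex.ext <;>
  · simp only [Complex.mul_re, Complex.mul_im, Complex.ofReal_re, Complex.ofReal_im, Complex.sub_re,
      Complex.sub_im, UpperHalfPlane.coe_re, UpperHalfPlane.coe_im, Complex.star_def,
      Complex.conj_re, Complex.conj_im]
    field_simp
    ring

/-- The hyperbolic law of cosines. -/
theorem cosh_dist_eq_angle (z w₁ w₂ : ℍ) : Real.cosh (dist w₁ w₂) =
    Real.cosh (dist z w₁) * Real.cosh (dist z w₂) -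
      Real.sinh (dist z w₁) * Real.sinh (dist z w₂) * Real.cos (angle z w₁ w₂) := by
  have hz := z.im_pos
  have key : ∀ w : ℍ,
      ‖(⟨(w.re - z.re) ^ 2 + w.im ^ 2 - z.im ^ 2, -2 * z.im * (w.re - z.re)⟩ : ℂ)‖ =
        2 * z.im * w.im * Real.sinh (dist z w) := fun w => by
    have hw := w.im_pos
    rw [← sq_eq_sq₀ (norm_nonneg _) (mul_nonneg (by positivity) (Real.sinh_nonneg_iff.2
      dist_nonneg)), Complex.sq_norm, Complex.normSq_apply, mul_pow, Real.sinh_sq,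
      UpperHalfPlane.cosh_dist']
    field_simp
    ring
  have h1 := w₁.im_pos
  have h2 := w₂.im_pos
  rw [angle, discCoord_eq_smul, discCoord_eq_smul,
    InnerProductGeometry.angle_smul_left_of_pos _ _ (by positivity),
    InnerProductGeometry.angle_smul_right_of_pos _ _ (by positivity)]
  have h := InnerProductGeometry.cos_angle_mul_norm_mul_norm
    (⟨(w₁.re - z.re) ^ 2 + w₁.im ^ 2 - z.im ^ 2, -2 * z.im * (w₁.re - z.re)⟩ : ℂ)
    (⟨(w₂.re - z.re) ^ 2 + w₂.im ^ 2 - z.im ^ 2, -2 * z.im * (w₂.re - z.re)⟩ : ℂ)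
  rw [key, key] at h
  have h3 : (inner ℝ (⟨(w₁.re - z.re) ^ 2 + w₁.im ^ 2 - z.im ^ 2, -2 * z.im * (w₁.re - z.re)⟩ : ℂ)
      (⟨(w₂.re - z.re) ^ 2 + w₂.im ^ 2 - z.im ^ 2, -2 * z.im * (w₂.re - z.re)⟩ : ℂ) : ℝ) =
      4 * z.im ^ 2 * w₁.im * w₂.im * (Real.cosh (dist z w₁) * Real.cosh (dist z w₂) -
        Real.cosh (dist w₁ w₂)) := by
    rw [Complex.inner, UpperHalfPlane.cosh_dist', UpperHalfPlane.cosh_dist',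
      UpperHalfPlane.cosh_dist']
    simp
    field_simp
    ring
  rw [h3] at h
  have h4 : (4 * z.im ^ 2 * w₁.im * w₂.im) ≠ 0 := by positivity
  apply mul_left_cancel₀ h4
  linear_combination h

theorem angle_nonneg (z w₁ w₂ : ℍ) : 0 ≤ angle z w₁ w₂ := InnerProductGeometry.angle_nonneg _ _

theorem angle_le_pi (z w₁ w₂ : ℍ) : angle z w₁ w₂ ≤ Real.pi := InnerProductGeometry.angle_le_pi _ _

/-- The default value π/2 at a degenerate vertex differs from the prescribed angles π/m with m ≥ 3;
this is what makes the vertices distinct. -/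
theorem angle_self_left (z w : ℍ) : angle z z w = Real.pi / 2 := by
  simp [angle, discCoord]

/-! ### The root datum of a triangle -/

section Triangle

theorem fin_add_one_add_one (k : Fin 3) : k + 1 + 1 = k + 2 := by revert k; decide
theorem fin_add_one_add_two (k : Fin 3) : k + 1 + 2 = k := by revert k; decide
theorem fin_add_two_add_one (k : Fin 3) : k + 2 + 1 = k := by revert k; decide
theorem fin_add_two_add_two (k : Fin 3) : k + 2 + 2 = k + 1 := by revert k; decide

variable {V : Fin 3 → ℍ} {m : Fin 3 → ℕ}

theorem pi_div_lt {m : ℕ} (hm : 3 ≤ m) : Real.pi / m < Real.pi / 2 := by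
  have : (3 : ℝ) ≤ m := by exact_mod_cast hm
  have := Real.pi_pos
  gcongr
  linarith

theorem ne_of_angles (hm : ∀ k, 3 ≤ m k)
    (hV : ∀ k, angle (V k) (V (k + 1)) (V (k + 2)) = Real.pi / m k) (k : Fin 3) :
    V k ≠ V (k + 1) := fun h => by
  have h1 := hV k
  rw [← h, angle_self_left] at h1
  have := pi_div_lt (hm k)
  linarith

theorem sinh_pos_of_ne {a b : ℍ} (h : a ≠ b) : 0 < Real.sinh (dist a b) :=
  Real.sinh_pos_iff.2 (dist_pos.2 h)

/-- The determinant of the vertices. -/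
noncomputable def vdet (V : Fin 3 → ℍ) : ℝ := mink (cross (vec (V 0)) (vec (V 1))) (vec (V 2))

theorem vdet_eq (V : Fin 3 → ℍ) (k : Fin 3) :
    mink (cross (vec (V (k + 1))) (vec (V (k + 2)))) (vec (V k)) = vdet V := by
  fin_cases k
  · exact (mink_cross_rotate _ _ _).symm
  · exact mink_cross_rotate _ _ _
  · rfl

theorem sin_pi_div_pos {m : ℕ} (hm : 3 ≤ m) : 0 < Real.sin (Real.pi / m) := by
  have : (3 : ℝ) ≤ m := by exact_mod_cast hm
  have := Real.pi_pos
  exact Real.sin_pos_of_pos_of_lt_pi (by positivity) (by linarith [pi_div_lt hm])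

/-- The sine law: the determinant of the vertices has the same expression at each of them, by the
law of cosines inserted in the Gram determinant. -/
theorem vdet_sq (hV : ∀ k, angle (V k) (V (k + 1)) (V (k + 2)) = Real.pi / m k) (k : Fin 3) :
    vdet V ^ 2 = (Real.sinh (dist (V k) (V (k + 1))) * Real.sinh (dist (V k) (V (k + 2))) *
      Real.sin (Real.pi / m k)) ^ 2 := by
  have h3 := cosh_dist_eq_angle (V k) (V (k + 1)) (V (k + 2))
  rw [hV] at h3
  rw [← vdet_eq V k, mink_cross_sq, mink_vec_self, mink_vec_self, mink_vec_self, mink_vec, mink_vec,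
    mink_vec, dist_comm (V (k + 1)) (V k), dist_comm (V (k + 2)) (V k), h3, mul_pow, mul_pow,
    Real.sin_sq, Real.sinh_sq, Real.sinh_sq]
  have e1 := Real.sinh_sq (dist (V k) (V (k + 1)))
  have e2 := Real.sinh_sq (dist (V k) (V (k + 2)))
  generalize Real.sinh (dist (V k) (V (k + 1))) = s1 at *
  generalize Real.sinh (dist (V k) (V (k + 2))) = s2 at *
  generalize Real.cosh (dist (V k) (V (k + 1))) = c1 at *
  generalize Real.cosh (dist (V k) (V (k + 2))) = c2 at *
  generalize Real.cos (Real.pi / m k) = c at *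
  linear_combination (-c ^ 2 * s2 ^ 2) * e1 - c ^ 2 * (c1 ^ 2 - 1) * e2

theorem ne_of_angles' (hm : ∀ k, 3 ≤ m k)
    (hV : ∀ k, angle (V k) (V (k + 1)) (V (k + 2)) = Real.pi / m k) (k : Fin 3) :
    V k ≠ V (k + 2) := by
  have h := ne_of_angles hm hV (k + 2)
  rw [fin_add_two_add_one] at h
  exact h.symm

theorem vdet_ne_zero (hm : ∀ k, 3 ≤ m k)
    (hV : ∀ k, angle (V k) (V (k + 1)) (V (k + 2)) = Real.pi / m k) : vdet V ≠ 0 := by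
  have h1 := sinh_pos_of_ne (ne_of_angles hm hV 0)
  have h2 := sinh_pos_of_ne (ne_of_angles' hm hV 0)
  have h5 := sin_pi_div_pos (hm 0)
  intro h
  have h6 := vdet_sq hV 0
  rw [h] at h6
  have := mul_pos (mul_pos h1 h2) h5
  nlinarith

/-- The inward unit normal of the side opposite to `V k`. -/
noncomputable def normal (V : Fin 3 → ℍ) (k : Fin 3) : ℝ × ℝ × ℝ :=
  (vdet V / |vdet V| / Real.sinh (dist (V (k + 1)) (V (k + 2)))) •
    cross (vec (V (k + 1))) (vec (V (k + 2)))

theorem sinh_side_pos (hm : ∀ k, 3 ≤ m k)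
    (hV : ∀ k, angle (V k) (V (k + 1)) (V (k + 2)) = Real.pi / m k) (k : Fin 3) :
    0 < Real.sinh (dist (V (k + 1)) (V (k + 2))) := by
  have := sinh_pos_of_ne (ne_of_angles hm hV (k + 1))
  rwa [fin_add_one_add_one] at this

theorem normal_norm (hm : ∀ k, 3 ≤ m k)
    (hV : ∀ k, angle (V k) (V (k + 1)) (V (k + 2)) = Real.pi / m k) (k : Fin 3) :
    mink (normal V k) (normal V k) = 1 := by
  have h1 := sinh_side_pos hm hV k
  have h2 := abs_pos.2 (vdet_ne_zero hm hV)
  have h3 := Real.sinh_sq (dist (V (k + 1)) (V (k + 2)))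
  have h4 : |vdet V| ^ 2 = vdet V ^ 2 := sq_abs _
  simp only [normal, map_smul, LinearMap.smul_apply, smul_eq_mul, mink_cross_cross, mink_vec_self,
    mink_symm (vec (V (k + 2))), mink_vec]
  field_simp
  linear_combination -vdet V ^ 2 * h3 - Real.sinh (dist (V (k + 1)) (V (k + 2))) ^ 2 * h4

theorem normal_form_vertex (V : Fin 3 → ℍ) (k : Fin 3) : mink (normal V k) (vec (V k)) =
    |vdet V| / Real.sinh (dist (V (k + 1)) (V (k + 2))) := by
  rw [normal, map_smul, LinearMap.smul_apply, vdet_eq, smul_eq_mul]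
  by_cases h : vdet V = 0
  · simp [h]
  have h1 : |vdet V| ≠ 0 := abs_ne_zero.2 h
  have h4 : |vdet V| ^ 2 = vdet V ^ 2 := sq_abs _
  rw [div_mul_eq_mul_div]
  congr 1
  field_simp
  exact h4.symm

theorem normal_orthogonal (V : Fin 3 → ℍ) {i k : Fin 3} (h : i ≠ k) :
    mink (normal V i) (vec (V k)) = 0 := by
  have : k = i + 1 ∨ k = i + 2 := by revert i k; decide
  rw [normal, map_smul, LinearMap.smul_apply]
  rcases this with rfl | rfl
  · rw [mink_cross_left, smul_zero]
  · rw [mink_cross_right, smul_zero]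

theorem normal_gram (hm : ∀ k, 3 ≤ m k)
    (hV : ∀ k, angle (V k) (V (k + 1)) (V (k + 2)) = Real.pi / m k) (k : Fin 3) :
    mink (normal V (k + 1)) (normal V (k + 2)) = -Real.cos (Real.pi / m k) := by
  have h1 := sinh_side_pos hm hV (k + 1)
  have h2 := sinh_side_pos hm hV (k + 2)
  have h3 := cosh_dist_eq_angle (V k) (V (k + 1)) (V (k + 2))
  have h4 : |vdet V| ^ 2 = vdet V ^ 2 := sq_abs _
  have h5 := abs_pos.2 (vdet_ne_zero hm hV)
  rw [hV] at h3
  simp only [normal, fin_add_one_add_one, fin_add_one_add_two, fin_add_two_add_one,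
    fin_add_two_add_two, map_smul, LinearMap.smul_apply, smul_eq_mul, mink_cross_cross,
    mink_vec_self] at h1 h2 ⊢
  rw [mink_vec, mink_vec, mink_vec, dist_comm (V (k + 2)) (V k), dist_comm (V (k + 2)) (V (k + 1)),
    h3]
  rw [dist_comm (V (k + 2)) (V k)] at h1
  field_simp
  rw [h4]
  ring

theorem exists_sum_normal (hm : ∀ k, 3 ≤ m k)
    (hV : ∀ k, angle (V k) (V (k + 1)) (V (k + 2)) = Real.pi / m k) (v : ℝ × ℝ × ℝ) :
    v = ∑ i, (mink v (vec (V i)) / mink (normal V i) (vec (V i))) • normal V i := by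
  have hne : ∀ i, mink (normal V i) (vec (V i)) ≠ 0 := fun i => by
    rw [normal_form_vertex]
    exact (div_pos (abs_pos.2 (vdet_ne_zero hm hV)) (sinh_side_pos hm hV i)).ne'
  rw [← sub_eq_zero]
  have key : ∀ k, mink (v - ∑ i, (mink v (vec (V i)) / mink (normal V i) (vec (V i))) • normal V i)
      (vec (V k)) = 0 := fun k => by
    rw [map_sub, map_sum, LinearMap.sub_apply, LinearMap.sum_apply, Finset.sum_eq_single k]
    · rw [map_smul, LinearMap.smul_apply, smul_eq_mul, div_mul_cancel₀ _ (hne k), sub_self]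
    · intro i _ hi
      rw [map_smul, LinearMap.smul_apply, normal_orthogonal V hi, smul_zero]
    · simp
  exact eq_zero_of_orthogonal (vdet_ne_zero hm hV) (key 0) (key 1) (key 2)

/-- The root datum of a triangle in the hyperboloid model. -/
noncomputable def triangleDatum (V : Fin 3 → ℍ) (m : Fin 3 → ℕ) (hm : ∀ k, 3 ≤ m k)
    (hm4 : ∃ k, 4 ≤ m k) (hV : ∀ k, angle (V k) (V (k + 1)) (V (k + 2)) = Real.pi / m k) :
    TriangleDatum (ℝ × ℝ × ℝ) where
  B := mink
  α := normal V
  -- For i ≠ j the third index is -(i + j), as 0 + 1 + 2 = 0 in `Fin 3`; the sides i and j meet in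
  -- that vertex.
  m i j := m (-(i + j))
  symm := mink_symm
  norm := normal_norm hm hV
  two_le i j _ := (by norm_num : 2 ≤ 3).trans (hm _)
  gram i j hij := by
    have : (∃ k, i = k + 1 ∧ j = k + 2 ∧ -(i + j) = k) ∨
      (∃ k, i = k + 2 ∧ j = k + 1 ∧ -(i + j) = k) := by revert i j; decide
    rcases this with ⟨k, h1, h2, h3⟩ | ⟨k, h1, h2, h3⟩
    · rw [h3, h1, h2, normal_gram hm hV]
    · rw [h3, h1, h2, mink_symm, normal_gram hm hV]
  three_le i j _ := hm _
  four_le a b c hab hbc hac := by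
    obtain ⟨k, hk⟩ := hm4
    have : -(a + b) = k ∨ -(b + c) = k ∨ -(a + c) = k := by
      clear hk
      revert a b c k; decide
    rcases this with h | h | h
    · exact .inl (by rw [h]; exact hk)
    · exact .inr (.inl (by rw [h]; exact hk))
    · exact .inr (.inr (by rw [h]; exact hk))
  lorentz := mink_lorentz
  span v := ⟨_, exists_sum_normal hm hV v⟩
  vtx k := vec (V k)
  vtx_norm k := mink_vec_self _
  vtx_orthogonal _ _ h := normal_orthogonal V h
  vtx_pos k := by
    rw [normal_form_vertex]
    exact div_pos (abs_pos.2 (vdet_ne_zero hm hV)) (sinh_side_pos hm hV k)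

end Triangle

/-! ### The inscribed circle -/

theorem dist_le_iff_mink {a b : ℍ} {ρ : ℝ} (hρ : 0 ≤ ρ) :
    ρ ≤ dist a b ↔ mink (vec a) (vec b) ≤ -Real.cosh ρ := by
  rw [mink_vec, neg_le_neg_iff, Real.cosh_le_cosh, abs_of_nonneg hρ, abs_of_nonneg dist_nonneg]

theorem dist_eq_iff_mink_eq {a b : ℍ} {ρ : ℝ} (hρ : 0 ≤ ρ) :
    dist a b = ρ ↔ mink (vec a) (vec b) = -Real.cosh ρ := by
  rw [mink_vec, neg_inj]
  exact ⟨fun h => by rw [h], fun h => by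
    have := congrArg Real.arcosh h
    rwa [Real.arcosh_cosh dist_nonneg, Real.arcosh_cosh hρ] at this⟩

/-- The distances of the endpoints of a segment to its points. -/
theorem sinh_dist_of_combo {a b c : ℍ} {s t : ℝ} (ht : 0 ≤ t)
    (h : vec c = s • vec a + t • vec b) :
    Real.cosh (dist a c) = s + t * Real.cosh (dist a b) ∧
      Real.sinh (dist a c) = t * Real.sinh (dist a b) := by
  have h0 := mink_vec_self c
  have h1 := mink_vec a c
  rw [h] at h0 h1
  simp only [map_add, map_smul, LinearMap.add_apply, LinearMap.smul_apply, smul_eq_mul,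
    mink_vec, dist_self, Real.cosh_zero, dist_comm b a] at h0 h1
  have h2 : Real.cosh (dist a c) = s + t * Real.cosh (dist a b) := by linarith
  refine ⟨h2, ?_⟩
  have hs := Real.sinh_nonneg_iff.2 (dist_nonneg : 0 ≤ dist a b)
  have hs' := Real.sinh_nonneg_iff.2 (dist_nonneg : 0 ≤ dist a c)
  rw [← sq_eq_sq₀ hs' (mul_nonneg ht hs), mul_pow, Real.sinh_sq, Real.sinh_sq, h2]
  linarith

theorem mem_segment_of_combo {a b c : ℍ} {s t : ℝ} (hs : 0 ≤ s) (ht : 0 ≤ t)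
    (h : vec c = s • vec a + t • vec b) : c ∈ segment a b := by
  obtain ⟨h1, h2⟩ := sinh_dist_of_combo ht h
  obtain ⟨h3, h4⟩ := sinh_dist_of_combo (a := b) (b := a) hs (by rw [h, add_comm])
  have h0 := mink_vec_self c
  rw [h] at h0
  simp only [map_add, map_smul, LinearMap.add_apply, LinearMap.smul_apply, smul_eq_mul,
    mink_vec, dist_self, Real.cosh_zero, dist_comm b a] at h0
  have h5 : Real.cosh (dist a c + dist b c) = Real.cosh (dist a b) := by
    rw [Real.cosh_add, h1, h2, h3, h4, dist_comm b a]
    linear_combination s * t * Real.cosh_sq (dist a b) * (-1) - Real.cosh (dist a b) * h0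
  have h6 := congrArg Real.arcosh h5
  rw [Real.arcosh_cosh (by positivity), Real.arcosh_cosh dist_nonneg] at h6
  rw [segment, Set.mem_ofPred_eq, dist_comm c b, h6]

section Triangle

variable {V : Fin 3 → ℍ} {m : Fin 3 → ℕ}

theorem altitude_pos (hm : ∀ k, 3 ≤ m k)
    (hV : ∀ k, angle (V k) (V (k + 1)) (V (k + 2)) = Real.pi / m k) (k : Fin 3) :
    0 < mink (normal V k) (vec (V k)) := by
  rw [normal_form_vertex]
  exact div_pos (abs_pos.2 (vdet_ne_zero hm hV)) (sinh_side_pos hm hV k)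

theorem exists_sum_vertex (hm : ∀ k, 3 ≤ m k)
    (hV : ∀ k, angle (V k) (V (k + 1)) (V (k + 2)) = Real.pi / m k) (v : ℝ × ℝ × ℝ) :
    v = ∑ i, (mink (normal V i) v / mink (normal V i) (vec (V i))) • vec (V i) := by
  rw [← sub_eq_zero]
  set w := v - ∑ i, (mink (normal V i) v / mink (normal V i) (vec (V i))) • vec (V i) with hw
  have key : ∀ k, mink (normal V k) w = 0 := fun k => by
    rw [hw, map_sub, map_sum, Finset.sum_eq_single k]
    · rw [map_smul, smul_eq_mul, div_mul_cancel₀ _ (altitude_pos hm hV k).ne', sub_self]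
    · intro i _ hi
      rw [map_smul, normal_orthogonal V hi.symm, smul_zero]
    · simp
  have key' : ∀ u, mink w u = 0 := fun u => by
    rw [exists_sum_normal hm hV u, map_sum]
    exact Finset.sum_eq_zero fun i _ => by rw [map_smul, mink_symm w, key, smul_zero]
  exact eq_zero_of_orthogonal (vdet_ne_zero hm hV) (key' _) (key' _) (key' _)

/-- Dividing each vertex by its altitude and adding gives a vector with product 1 with all normals;
it is timelike because the vertices have products at most -1 with each other, and is then
normalised. -/
theorem exists_incenter (hm : ∀ k, 3 ≤ m k)
    (hV : ∀ k, angle (V k) (V (k + 1)) (V (k + 2)) = Real.pi / m k) :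
    ∃ (I : ℍ) (c : ℝ), 0 < c ∧ ∀ i, mink (normal V i) (vec I) = c := by
  set h : Fin 3 → ℝ := fun i => (mink (normal V i) (vec (V i)))⁻¹ with hh
  have hpos : ∀ i, 0 < h i := fun i => inv_pos.2 (altitude_pos hm hV i)
  set Y : ℝ × ℝ × ℝ := ∑ i, h i • vec (V i) with hY
  have h1 : ∀ k, mink (normal V k) Y = 1 := fun k => by
    rw [hY, map_sum, Finset.sum_eq_single k]
    · rw [map_smul, smul_eq_mul, hh, inv_mul_cancel₀ (altitude_pos hm hV k).ne']
    · intro i _ hi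
      rw [map_smul, normal_orthogonal V hi.symm, smul_zero]
    · simp
  have h2 : mink Y Y < 0 := by
    rw [hY, map_sum]
    refine Finset.sum_neg (fun i _ => ?_) Finset.univ_nonempty
    rw [map_sum, LinearMap.sum_apply]
    refine Finset.sum_neg (fun j _ => ?_) Finset.univ_nonempty
    simp only [map_smul, LinearMap.smul_apply, smul_eq_mul]
    have := mink_vec_le (V j) (V i)
    nlinarith [mul_pos (hpos i) (hpos j)]
  have h3 : 0 < Y.1 := by
    rw [hY, Prod.fst_sum]
    refine Finset.sum_pos (fun i _ => ?_) Finset.univ_nonempty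
    exact mul_pos (hpos i) (vec_fst_pos (V i))
  set c := (√(-mink Y Y))⁻¹ with hc
  have hc0 : 0 < c := inv_pos.2 (Real.sqrt_pos.2 (by linarith))
  have hc2 : c ^ 2 * mink Y Y = -1 := by
    have := h2.ne
    rw [hc, inv_pow, Real.sq_sqrt (by linarith)]
    field_simp
  obtain ⟨I, hI⟩ := exists_vec_eq (v := c • Y)
    (by simp only [map_smul, LinearMap.smul_apply, smul_eq_mul]; linarith) (mul_pos hc0 h3)
  exact ⟨I, c, hc0, fun i => by rw [hI, map_smul, h1, smul_eq_mul, mul_one]⟩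

theorem normal_form_of_mem_line {k : Fin 3} {x : ℍ} (hx : x ∈ line (V (k + 1)) (V (k + 2))) :
    mink (normal V k) (vec x) = 0 := by
  rw [normal, map_smul, LinearMap.smul_apply, mink_cross_eq_zero_of_mem_line hx, smul_zero]

theorem normal_form_le (hm : ∀ k, 3 ≤ m k)
    (hV : ∀ k, angle (V k) (V (k + 1)) (V (k + 2)) = Real.pi / m k) {i k : Fin 3} (h : i ≠ k) :
    mink (normal V i) (normal V k) < 0 := by
  have h1 : ∀ k, mink (normal V (k + 1)) (normal V (k + 2)) < 0 := fun k => by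
    rw [normal_gram hm hV]
    have := TriangleDatum.half_le_cos (hm k)
    linarith
  have : (∃ j, i = j + 1 ∧ k = j + 2) ∨ (∃ j, i = j + 2 ∧ k = j + 1) := by revert i k; decide
  rcases this with ⟨j, rfl, rfl⟩ | ⟨j, rfl, rfl⟩
  · exact h1 j
  · rw [mink_symm]; exact h1 j

/-- The circle around the incenter touches each side, in the interior of the side. -/
theorem exists_touching (hm : ∀ k, 3 ≤ m k)
    (hV : ∀ k, angle (V k) (V (k + 1)) (V (k + 2)) = Real.pi / m k) {I : ℍ} {c : ℝ} (hc : 0 < c)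
    (hI : ∀ i, mink (normal V i) (vec I) = c) (k : Fin 3) :
    ∃ x, TouchesSideAt I (Real.arsinh c) (V (k + 1)) (V (k + 2)) x ∧
      ∃ s t : ℝ, 0 < s ∧ 0 < t ∧ vec x = s • vec (V (k + 1)) + t • vec (V (k + 2)) := by
  set e := √(1 + c ^ 2) with he
  have he0 : 0 < e := Real.sqrt_pos.2 (by positivity)
  have he2 : e ^ 2 = 1 + c ^ 2 := Real.sq_sqrt (by positivity)
  have hN := normal_norm hm hV k
  -- The foot of the perpendicular from `I` to the side.
  set y := e⁻¹ • (vec I - c • normal V k) with hy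
  have hyI : mink (vec I) y = -e := by
    simp only [hy, map_sub, map_smul, smul_eq_mul, mink_vec_self,
      mink_symm (vec I) (normal V k), hI]
    field_simp; linarith
  have hyy : mink y y = -1 := by
    simp only [hy, map_sub, map_smul, LinearMap.sub_apply, LinearMap.smul_apply, smul_eq_mul,
      mink_vec_self, mink_symm (vec I) (normal V k), hI, hN]
    field_simp; linarith
  obtain ⟨x, hx⟩ := exists_vec_eq hyy (fst_pos_of_mink_neg (mink_vec_self I) hyy (vec_fst_pos I)
    (by rw [hyI]; linarith))
  have hk : mink (normal V k) (vec x) = 0 := by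
    rw [hx, hy, map_smul, map_sub, map_smul, hI, hN]; simp
  -- The foot lies in the interior of the side because the normals have negative products, the
  -- angles being acute.
  have hi : ∀ i, i ≠ k → 0 < mink (normal V i) (vec x) := fun i h => by
    rw [hx, hy, map_smul, map_sub, map_smul, hI, smul_eq_mul, smul_eq_mul]
    have := normal_form_le hm hV h
    exact mul_pos (inv_pos.2 he0) (by nlinarith)
  have hsum := exists_sum_vertex hm hV (vec x)
  have hu : (Finset.univ : Finset (Fin 3)) = {k, k + 1, k + 2} := by
    clear * -; revert k; decide
  have k1 : k + 1 ≠ k := by clear * -; revert k; decide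
  have k2 : k + 2 ≠ k := by clear * -; revert k; decide
  have k3 : k + 1 ≠ k + 2 := by clear * -; revert k; decide
  rw [hu, Finset.sum_insert (by simp [k1.symm, k2.symm]), Finset.sum_insert (by simp [k3]),
    Finset.sum_singleton, hk, zero_div, zero_smul, zero_add] at hsum
  have hs := div_pos (hi _ k1) (altitude_pos hm hV (k + 1))
  have ht := div_pos (hi _ k2) (altitude_pos hm hV (k + 2))
  have hρ : 0 ≤ Real.arsinh c := Real.arsinh_nonneg_iff.2 hc.le
  refine ⟨x, ⟨mem_segment_of_combo hs.le ht.le hsum, ?_, fun z hz => ?_⟩, _, _, hs, ht, hsum⟩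
  · rw [dist_eq_iff_mink_eq hρ, Real.cosh_arsinh, hx, hyI]
  · rw [dist_le_iff_mink hρ, Real.cosh_arsinh]
    have h1 : mink (vec I) (vec z) = e * mink (vec x) (vec z) := by
      rw [hx, hy]
      simp only [map_sub, map_smul, LinearMap.sub_apply, LinearMap.smul_apply, smul_eq_mul,
        normal_form_of_mem_line hz]
      field_simp; ring
    rw [h1]
    have := mink_vec_le x z
    nlinarith

/-! ### Angles at the vertices -/

theorem altitude_eq_left (hm : ∀ k, 3 ≤ m k)
    (hV : ∀ k, angle (V k) (V (k + 1)) (V (k + 2)) = Real.pi / m k) (k : Fin 3) :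
    mink (normal V (k + 1)) (vec (V (k + 1))) =
      Real.sinh (dist (V k) (V (k + 1))) * Real.sin (Real.pi / m k) := by
  have h1 := sinh_pos_of_ne (ne_of_angles hm hV k)
  have h2 := sinh_pos_of_ne (ne_of_angles' hm hV k)
  have h3 := sin_pi_div_pos (hm k)
  have h4 := vdet_sq hV k
  rw [sq_eq_sq_iff_abs_eq_abs, abs_of_pos (mul_pos (mul_pos h1 h2) h3)] at h4
  rw [normal_form_vertex, h4, fin_add_one_add_one, fin_add_one_add_two, dist_comm (V (k + 2))]
  field_simp

theorem altitude_eq_right (hm : ∀ k, 3 ≤ m k)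
    (hV : ∀ k, angle (V k) (V (k + 1)) (V (k + 2)) = Real.pi / m k) (k : Fin 3) :
    mink (normal V (k + 2)) (vec (V (k + 2))) =
      Real.sinh (dist (V k) (V (k + 2))) * Real.sin (Real.pi / m k) := by
  have h1 := sinh_pos_of_ne (ne_of_angles hm hV k)
  have h2 := sinh_pos_of_ne (ne_of_angles' hm hV k)
  have h3 := sin_pi_div_pos (hm k)
  have h4 := vdet_sq hV k
  rw [sq_eq_sq_iff_abs_eq_abs, abs_of_pos (mul_pos (mul_pos h1 h2) h3)] at h4
  rw [normal_form_vertex, h4, fin_add_two_add_one, fin_add_two_add_two]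
  field_simp

theorem angle_eq_of_cos {z w₁ w₂ z' w₁' w₂' : ℍ}
    (h : Real.cos (angle z w₁ w₂) = Real.cos (angle z' w₁' w₂')) :
    angle z w₁ w₂ = angle z' w₁' w₂' :=
  Real.injOn_cos ⟨angle_nonneg _ _ _, angle_le_pi _ _ _⟩ ⟨angle_nonneg _ _ _, angle_le_pi _ _ _⟩ h

theorem angle_isometry (g : ℍ ≃ᵢ ℍ) {z w₁ w₂ : ℍ} (h1 : z ≠ w₁) (h2 : z ≠ w₂) :
    angle (g z) (g w₁) (g w₂) = angle z w₁ w₂ := by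
  apply angle_eq_of_cos
  have e1 := cosh_dist_eq_angle z w₁ w₂
  have e2 := cosh_dist_eq_angle (g z) (g w₁) (g w₂)
  simp only [g.dist_eq] at e2
  have h := mul_pos (sinh_pos_of_ne h1) (sinh_pos_of_ne h2)
  apply mul_left_cancel₀ h.ne'
  linarith

/-- The angle between a point and its mirror image, seen from a point on the mirror. -/
theorem angle_reflection {α : ℝ × ℝ × ℝ} {σ : ℍ ≃ᵢ ℍ}
    (hσ : ∀ z, vec (σ z) = mrefl α (vec z)) {z w : ℍ} (hz : σ z = z) (hzw : z ≠ w) {φ : ℝ}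
    (hφ : 0 ≤ φ) (hφ' : 2 * φ ≤ Real.pi)
    (h : mink α (vec w) = Real.sinh (dist z w) * Real.sin φ) : angle z w (σ w) = 2 * φ := by
  refine Real.injOn_cos ⟨angle_nonneg _ _ _, angle_le_pi _ _ _⟩ ⟨by linarith, hφ'⟩ ?_
  have e1 := cosh_dist_eq_angle z w (σ w)
  have e2 : dist z (σ w) = dist z w := by
    conv_lhs => rw [← hz]
    exact σ.dist_eq z w
  have e3 := mink_vec w (σ w)
  rw [hσ, mrefl, map_sub, map_smul, mink_vec_self, smul_eq_mul, mink_symm (vec w), h] at e3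
  rw [e2] at e1
  have h1 := sinh_pos_of_ne hzw
  have e4 := Real.cosh_sq (dist z w)
  rw [Real.cos_two_mul]
  apply mul_left_cancel₀ (pow_pos h1 2).ne'
  linear_combination e1 - e3 + e4 - 2 * Real.sinh (dist z w) ^ 2 * Real.sin_sq_add_cos_sq φ

end Triangle

/-! ### The incenter and positive roots -/

namespace TriangleDatum

variable {W : Type*} [AddCommGroup W] [Module ℝ W] (D : TriangleDatum W)

/-- Positive roots have product at least `c` with the incenter. -/
theorem le_form_of_isPos {o β : W} {c : ℝ} (hc : 0 ≤ c) (ho : ∀ i, D.B (D.α i) o = c)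
    (hβ : D.IsPos β) (hββ : D.B β β = 1) : c ≤ D.B β o := by
  obtain ⟨x, hx⟩ := D.span β
  have hx0 : ∀ k, 0 ≤ x k := fun k => by
    have h1 : 0 ≤ D.B β (D.vtx k) := hβ _ fun i => by
      by_cases h : i = k
      · rw [h]; exact (D.vtx_pos k).le
      · rw [D.vtx_orthogonal i k h]
    rw [hx, map_sum, LinearMap.sum_apply, Finset.sum_eq_single k] at h1
    · rw [map_smul, LinearMap.smul_apply, smul_eq_mul] at h1
      exact nonneg_of_mul_nonneg_left h1 (D.vtx_pos k)
    · intro i _ hi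
      rw [map_smul, LinearMap.smul_apply, D.vtx_orthogonal i k hi, smul_zero]
    · simp
  have h01 : ∀ i j, i ≠ j → D.B (D.α i) (D.α j) ≤ 0 := fun i j hij => by
    rw [D.gram i j hij]
    have := half_le_cos (D.three_le i j hij)
    linarith
  rw [hx] at hββ
  rw [hx]
  simp only [Fin.sum_univ_three, map_add, map_smul, LinearMap.add_apply, LinearMap.smul_apply,
    smul_eq_mul, D.norm, ho] at hββ ⊢
  have e1 := mul_nonneg (mul_nonneg (hx0 0) (hx0 1)) (neg_nonneg.2 (h01 0 1 (by decide)))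
  have e2 := mul_nonneg (mul_nonneg (hx0 0) (hx0 2)) (neg_nonneg.2 (h01 0 2 (by decide)))
  have e3 := mul_nonneg (mul_nonneg (hx0 1) (hx0 2)) (neg_nonneg.2 (h01 1 2 (by decide)))
  rw [D.symm (D.α 1) (D.α 0), D.symm (D.α 2) (D.α 0), D.symm (D.α 2) (D.α 1)] at hββ
  -- The mixed Gram entries are at most 0, so 1 = B(β, β) is at most the sum of the squares of the
  -- coordinates.
  have hsum : 1 ≤ (x 0 + x 1 + x 2) ^ 2 := by
    nlinarith [mul_nonneg (hx0 0) (hx0 1), mul_nonneg (hx0 0) (hx0 2), mul_nonneg (hx0 1) (hx0 2)]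
  have hsum' : 1 ≤ x 0 + x 1 + x 2 :=
    (one_le_sq_iff₀ (add_nonneg (add_nonneg (hx0 0) (hx0 1)) (hx0 2))).1 hsum
  nlinarith

/-- The incenter is displaced in proportion to the length of the word. -/
theorem form_incenter_le {o : W} {c : ℝ} (hc : 0 ≤ c) (ho : ∀ i, D.B (D.α i) o = c)
    (hoo : D.B o o = -1) {l : List (Fin 3)} (hl : D.len (D.wp l) = l.length) :
    D.B o (D.wp l o) ≤ -1 - 2 * c ^ 2 * l.length := by
  induction l using List.reverseRecOn with
  | nil => simp [hoo]
  | append_singleton l j ih =>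
    have h1 := D.len_of_prefix hl
    have h2 : c ≤ D.B (D.wp l (D.α j)) o := by
      refine D.le_form_of_isPos hc ho (D.isPos_of_len_le l j ?_) (by rw [D.form_wp_wp, D.norm])
      rw [RootDatum.wp_append, RootDatum.wp_cons, RootDatum.wp_nil, mul_one] at hl
      rw [hl, h1]; simp
    have h3 := ih h1
    rw [RootDatum.wp_append, Module.End.mul_apply, RootDatum.wp_cons, RootDatum.wp_nil, mul_one,
      RootDatum.refl_apply, map_sub, map_smul, map_sub, map_smul, smul_eq_mul, ho,
      D.symm o (D.wp l (D.α j))]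
    simp only [List.length_append, List.length_singleton]
    push_cast
    nlinarith

end TriangleDatum

/-! ### Isometries given by words -/

/-- The isometry given by a word in the generators. -/
noncomputable def iso (s : Fin 3 → ℍ ≃ᵢ ℍ) (l : List (Fin 3)) : ℍ ≃ᵢ ℍ := (l.map s).prod

theorem vec_iso {D : TriangleDatum (ℝ × ℝ × ℝ)} {s : Fin 3 → ℍ ≃ᵢ ℍ}
    (hs : ∀ i z, vec (s i z) = D.refl i (vec z)) (l : List (Fin 3)) (z : ℍ) :
    vec (iso s l z) = D.wp l (vec z) := by
  induction l with
  | nil => simp [iso]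
  | cons i l ih =>
    have : iso s (i :: l) = s i * iso s l := by simp [iso]
    rw [this, IsometryEquiv.mul_apply, hs, ih, RootDatum.wp_cons, Module.End.mul_apply]

/-- Every point can be moved into the fundamental chamber. -/
theorem exists_mem_chamber {D : TriangleDatum (ℝ × ℝ × ℝ)} {s : Fin 3 → ℍ ≃ᵢ ℍ} (hB : D.B = mink)
    (hs : ∀ i z, vec (s i z) = D.refl i (vec z)) {o : ℍ} {c : ℝ} (hc : 0 < c)
    (ho : ∀ i, D.B (D.α i) (vec o) = c) (z : ℍ) : ∃ l, D.wp (List.reverse l) (vec z) ∈ D.chamber := by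
  -- Reduced words that bring the incenter no farther from `z` have bounded length, so a nearest
  -- image of the incenter exists.
  have hbound : ∀ r, D.len (D.wp r) = r.length → dist z (iso s r o) ≤ dist z o →
      (r.length : ℝ) ≤ Real.cosh (dist o z + dist z o) / (2 * c ^ 2) := fun r hr h => by
    have h1 := D.form_incenter_le hc.le ho (by rw [hB, mink_vec_self]) hr
    rw [← vec_iso hs, hB, mink_vec] at h1
    have h2 : Real.cosh (dist o (iso s r o)) ≤ Real.cosh (dist o z + dist z o) := by
      rw [Real.cosh_le_cosh, abs_of_nonneg dist_nonneg, abs_of_nonneg (by positivity)]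
      exact (dist_triangle _ z _).trans (by gcongr)
    rw [le_div_iff₀ (by positivity)]
    linarith
  obtain ⟨N, hN⟩ := exists_nat_ge (Real.cosh (dist o z + dist z o) / (2 * c ^ 2))
  obtain ⟨l, -, hmin⟩ := Set.exists_min_image {l : List (Fin 3) | l.length ≤ N}
    (fun l => dist z (iso s l o)) (List.finite_length_le _ _) ⟨[], by simp⟩
  have hmin' : ∀ r, dist z (iso s l o) ≤ dist z (iso s r o) := fun r => by
    obtain ⟨r', hr, hr'⟩ := D.exists_reduced r
    have h1 : iso s r o = iso s r' o := vec_injective (by rw [vec_iso hs, vec_iso hs, hr])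
    rw [h1]
    by_cases h : dist z (iso s r' o) ≤ dist z o
    · have := (hbound r' (by rw [hr, hr']) h).trans hN
      exact hmin r' (by exact_mod_cast this)
    · exact (hmin [] (by simp)).trans (by simpa [iso] using (not_le.1 h).le)
  refine ⟨l, fun i => ?_⟩
  -- A nearest image is not beaten by its mirror images in the walls of its own chamber, which puts
  -- `z` on the right side of each wall.
  have h1 := hmin' (l ++ [i])
  have h2 : mink (vec z) (vec (iso s (l ++ [i]) o)) ≤ mink (vec z) (vec (iso s l o)) := by
    rwa [mink_vec, mink_vec, neg_le_neg_iff, Real.cosh_le_cosh, abs_of_nonneg dist_nonneg,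
      abs_of_nonneg dist_nonneg]
  rw [vec_iso hs, vec_iso hs, ← hB, RootDatum.wp_append, Module.End.mul_apply, RootDatum.wp_cons,
    RootDatum.wp_nil, mul_one, RootDatum.refl_apply, map_sub, map_smul, map_sub, map_smul,
    smul_eq_mul, ho, D.symm (vec z) (D.wp l (D.α i)), RootDatum.form_wp_left] at h2
  nlinarith

/-! ### Hyperbolic isometries -/

/-- The displacement function of a hyperbolic isometry in the hyperboloid model; `n` is the unit
normal of the axis. -/
theorem IsHyperbolic.exists_normal {γ : ℍ ≃ᵢ ℍ} (h : IsHyperbolic γ) :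
    ∃ (κ : ℝ) (n : ℝ × ℝ × ℝ), 0 < κ ∧ mink n n = 1 ∧
      (∀ z, Real.cosh (dist z (γ z)) = 1 + κ * (1 + mink (vec z) n ^ 2)) ∧
      ∃ z, mink n (vec z) = 0 ∧ mink n (vec (γ z)) = 0 := by
  obtain ⟨g, hg, hγ⟩ := h
  have hdet : g 0 0 * g 1 1 - g 0 1 * g 1 0 = 1 := by
    have := g.det_coe
    rwa [Matrix.det_fin_two] at this
  rw [Matrix.IsHyperbolic, Matrix.discr_fin_two, Matrix.trace_fin_two, Matrix.det_fin_two] at hg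
  set a := g 0 0 with ha
  set b := g 0 1 with hb
  set c := g 1 0 with hc
  set d := g 1 1 with hd
  -- The discriminant of the fixed point equation cz² + (d - a)z - b = 0, equal to tr² - 4. The
  -- coefficients of this equation give the normal of the axis, and κ = Δ/2.
  set Δ := (d - a) ^ 2 + 4 * b * c with hΔ
  have hΔ0 : 0 < Δ := by linear_combination hg
  have hsq : √Δ ^ 2 = Δ := Real.sq_sqrt hΔ0.le
  have hsq0 : 0 < √Δ := Real.sqrt_pos.2 hΔ0
  have hcosh : ∀ z : ℍ, Real.cosh (dist z (γ z)) = 1 + Δ / 2 * (1 + mink (vec z)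
      ((√Δ)⁻¹ • ((b - c, b + c, d - a) : ℝ × ℝ × ℝ)) ^ 2) := fun z => by
    have hy := z.im_pos
    have hγz : ((γ z : ℍ) : ℂ) = (a * z + b) / (c * z + d) := by
      rw [hγ z, UpperHalfPlane.coe_specialLinearGroup_apply]; simp [ha, hb, hc, hd]
    have hN0 : (c * z + d : ℂ) ≠ 0 := fun h0 => by
      have h1 := congrArg Complex.im h0
      have h2 := congrArg Complex.re h0
      simp at h1 h2
      rcases h1 with h1 | h1
      · rw [h1] at h2 hdet; simp at h2; rw [h2] at hdet; simp at hdet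
      · exact hy.ne' h1
    have hN : 0 < Complex.normSq (c * z + d : ℂ) := Complex.normSq_pos.2 hN0
    have him : (γ z).im = z.im / Complex.normSq (c * z + d : ℂ) := by
      rw [← UpperHalfPlane.coe_im, hγz, Complex.div_im]
      simp
      field_simp
      linear_combination hdet
    have hdist : dist (z : ℂ) (γ z : ℍ) ^ 2 =
        Complex.normSq (c * z ^ 2 + (d - a) * z - b) / Complex.normSq (c * z + d : ℂ) := by
      rw [Complex.dist_eq, Complex.sq_norm, ← Complex.normSq_div, hγz]
      congr 1
      rw [eq_div_iff hN0, sub_mul, div_mul_cancel₀ _ hN0]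
      ring
    have hnum : Complex.normSq (c * z ^ 2 + (d - a) * z - b) =
        (c * (z.re ^ 2 + z.im ^ 2) + (d - a) * z.re - b) ^ 2 + z.im ^ 2 * Δ := by
      rw [Complex.normSq_apply]
      simp [pow_two]
      ring
    have hm : mink (vec z) ((b - c, b + c, d - a) : ℝ × ℝ × ℝ) =
        (c * (z.re ^ 2 + z.im ^ 2) + (d - a) * z.re - b) / z.im := by
      simp only [mink_apply, vec]
      field_simp
      ring
    rw [UpperHalfPlane.cosh_dist, hdist, him, hnum, map_smul, hm, smul_eq_mul, mul_pow, inv_pow,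
      hsq]
    field_simp
    ring
  have hκ : 0 < Δ / 2 := by positivity
  refine ⟨Δ / 2, (√Δ)⁻¹ • ((b - c, b + c, d - a) : ℝ × ℝ × ℝ), hκ, ?_, hcosh, ?_⟩
  · rw [map_smul, map_smul, LinearMap.smul_apply, smul_eq_mul, smul_eq_mul, ← mul_assoc, ← sq,
      inv_pow, hsq, mink_apply]
    field_simp
    ring
  have haxis : ∃ z : ℍ, mink ((√Δ)⁻¹ • ((b - c, b + c, d - a) : ℝ × ℝ × ℝ)) (vec z) = 0 := by
    -- The axis is a vertical line if c = 0; otherwise the top of the semicircle is chosen.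
    have hz : ∃ x y : ℝ, 0 < y ∧ c * (x ^ 2 + y ^ 2) + (d - a) * x - b = 0 := by
      by_cases h0 : c = 0
      · have h1 : d - a ≠ 0 := fun h => by
          rw [hΔ, h0, h] at hΔ0; simp at hΔ0
        exact ⟨b / (d - a), 1, one_pos, by rw [h0]; field_simp; ring⟩
      · refine ⟨(a - d) / (2 * c), √Δ / (2 * |c|), by positivity, ?_⟩
        rw [div_pow, div_pow, hsq, mul_pow, mul_pow, sq_abs]
        field_simp
        rw [hΔ]; ring
    obtain ⟨x, y, hy, hxy⟩ := hz
    refine ⟨⟨⟨x, y⟩, hy⟩, ?_⟩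
    rw [map_smul, LinearMap.smul_apply]
    have : mink ((b - c, b + c, d - a) : ℝ × ℝ × ℝ) (vec ⟨⟨x, y⟩, hy⟩) =
        (c * (x ^ 2 + y ^ 2) + (d - a) * x - b) / y := by
      simp only [mink_apply, vec, UpperHalfPlane.re, UpperHalfPlane.im]
      field_simp
      ring
    rw [this, hxy, zero_div, smul_zero]
  obtain ⟨z, hz⟩ := haxis
  refine ⟨z, hz, ?_⟩
  -- γ commutes with itself, so z and γz have the same displacement, and the displacement determines
  -- the square of the product with `n`.
  have h1 := hcosh z
  have h2 := hcosh (γ z)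
  rw [γ.dist_eq, h1] at h2
  rw [mink_symm] at hz ⊢
  rw [hz] at h2
  have h3 := mul_left_cancel₀ hκ.ne' (add_left_cancel h2)
  have h4 := add_left_cancel h3
  rw [zero_pow two_ne_zero] at h4
  exact pow_eq_zero_iff two_ne_zero |>.1 h4.symm

/-! ### Generators, edges and words -/

section Triangle

variable {V : Fin 3 → ℍ} {m : Fin 3 → ℕ}

theorem isReflection_iff (hm : ∀ k, 3 ≤ m k)
    (hV : ∀ k, angle (V k) (V (k + 1)) (V (k + 2)) = Real.pi / m k) (i : Fin 3) (σ : ℍ ≃ᵢ ℍ) :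
    IsReflection (V (i + 1)) (V (i + 2)) σ ↔ ∀ z, vec (σ z) = mrefl (normal V i) (vec z) := by
  constructor
  · rintro ⟨h1, h2⟩
    refine vec_of_fixes (normal_norm hm hV i) (fun v hv1 hv2 => ?_) h1
      (h2 _ (left_mem_line _ _)) (h2 _ (right_mem_line _ _))
    refine ⟨_, (exists_sum_normal hm hV v).trans (Finset.sum_eq_single i (fun j _ hj => ?_) ?_)⟩
    · have : j = i + 1 ∨ j = i + 2 := by clear * - hj; revert i j; decide
      rcases this with rfl | rfl
      · rw [hv1, zero_div, zero_smul]
      · rw [hv2, zero_div, zero_smul]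
    · simp
  · refine fun h => ⟨fun h1 => ?_, fun x hx => vec_injective ?_⟩
    · have h2 := h (V i)
      rw [h1, IsometryEquiv.coe_one, id, mrefl, eq_comm, sub_eq_self] at h2
      have h3 := congrArg (mink (normal V i)) h2
      rw [map_smul, normal_norm hm hV, map_zero, smul_eq_mul, mul_one] at h3
      have := altitude_pos hm hV i
      linarith
    · rw [h, mrefl, normal_form_of_mem_line hx]; simp

/-- The angle at a vertex between a point of an adjacent side and its mirror image in the other
adjacent side. -/
theorem angle_vertex {σ : ℍ ≃ᵢ ℍ} {k j : Fin 3} (hkj : j ≠ k) (hne : V k ≠ V j)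
    (hσ : ∀ z, vec (σ z) = mrefl (normal V j) (vec z)) {n : ℕ} (hn : 3 ≤ n)
    (halt : mink (normal V j) (vec (V j)) = Real.sinh (dist (V k) (V j)) * Real.sin (Real.pi / n))
    {c : ℍ} {s t : ℝ} (ht : 0 < t) (hc : vec c = s • vec (V k) + t • vec (V j)) :
    σ (V k) = V k ∧ V k ≠ c ∧ angle (V k) c (σ c) = 2 * Real.pi / n := by
  have h1 : σ (V k) = V k := vec_injective (by rw [hσ, mrefl, normal_orthogonal V hkj]; simp)
  have h2 := (sinh_dist_of_combo ht.le hc).2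
  have h3 : V k ≠ c := by
    have := mul_pos ht (sinh_pos_of_ne hne)
    rw [← h2] at this
    exact dist_pos.1 (Real.sinh_pos_iff.1 this)
  have h4 := pi_div_lt hn
  refine ⟨h1, h3, ?_⟩
  rw [mul_div_assoc]
  refine angle_reflection hσ h1 h3 (by have := Real.pi_pos; positivity) (by linarith) ?_
  rw [hc, map_add, map_smul, map_smul, normal_orthogonal V hkj, smul_zero, zero_add, halt, h2,
    smul_eq_mul, mul_assoc]

end Triangle

theorem Triangle.isEdge_of_reflection {T : Triangle} {c v : ℍ} (hc : T.IsContactPoint c)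
    {g σ : ℍ ≃ᵢ ℍ} (hg : g ∈ T.fullGroup) (hσ : σ ∈ T.fullGroup) {n : ℕ} (hv : σ v = v)
    (hvc : v ≠ c) (hang : angle v c (σ c) = 2 * Real.pi / n) : T.IsEdge v n (g c) (g (σ c)) := by
  have hd : dist v (σ c) = dist v c := by
    conv_lhs => rw [← hv]
    exact σ.dist_eq v c
  refine ⟨⟨g, hg, c, hc, rfl⟩, ⟨g * σ, mul_mem hg hσ, c, hc, rfl⟩, g, hg, c, hc, g.dist_eq _ _, ?_, ?_⟩
  · rw [g.dist_eq, hd]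
  · rw [angle_isometry g hvc, hang]
    rw [← dist_pos, hd]
    exact dist_pos.2 hvc

/-- Data attached to a triangle: the contact point and generators of `Γ₀`, whose graph distances
are at most one. -/
theorem Triangle.exists_generators {T : Triangle} {r p q : ℕ} (hm : ∀ k, 3 ≤ ![r, p, q] k)
    (hV : ∀ k, angle (![T.R, T.P, T.Q] k) (![T.R, T.P, T.Q] (k + 1)) (![T.R, T.P, T.Q] (k + 2)) =
      Real.pi / (![r, p, q] k : ℕ)) :
    ∃ (c : ℍ) (s : Fin 3 → ℍ ≃ᵢ ℍ), T.IsContactPoint c ∧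
      (∀ i z, vec (s i z) = mrefl (normal ![T.R, T.P, T.Q] i) (vec z)) ∧
      T.fullGroup = Subgroup.closure (Set.range s) ∧
      ∀ g ∈ T.fullGroup, ∀ i, (T.graph r p).edist (g c) (g (s i c)) ≤ 1 := by
  obtain ⟨I, ρ, hρ, hI⟩ := exists_incenter hm hV
  obtain ⟨x₀, hx₀, -⟩ := exists_touching hm hV hρ hI 0
  obtain ⟨x₁, hx₁, -⟩ := exists_touching hm hV hρ hI 1
  obtain ⟨c, hc, a, b, ha, hb, hcab⟩ := exists_touching hm hV hρ hI 2
  have hcon : T.IsContactPoint c :=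
    ⟨I, Real.arsinh ρ, Real.arsinh_pos_iff.2 hρ, hc, ⟨x₀, hx₀⟩, ⟨x₁, hx₁⟩⟩
  choose s hs using fun i => exists_isometry_mrefl (normal_norm hm hV i)
  have hrefl : ∀ i σ, IsReflection (![T.R, T.P, T.Q] (i + 1)) (![T.R, T.P, T.Q] (i + 2)) σ ↔
      σ = s i := fun i σ => by
    rw [isReflection_iff hm hV i σ]
    exact ⟨fun h => IsometryEquiv.ext fun z => vec_injective (by rw [h, hs]),
      fun h z => by rw [h, hs]⟩
  have hfull : T.fullGroup = Subgroup.closure (Set.range s) := by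
    rw [Triangle.fullGroup]
    congr 1
    ext σ
    have h0 : IsReflection T.P T.Q σ ↔ σ = s 0 := hrefl 0 σ
    have h1 : IsReflection T.Q T.R σ ↔ σ = s 1 := hrefl 1 σ
    have h2 : IsReflection T.R T.P σ ↔ σ = s 2 := hrefl 2 σ
    rw [Set.mem_ofPred_eq, h0, h1, h2]
    constructor
    · rintro (h | h | h) <;> exact ⟨_, h.symm⟩
    · rintro ⟨i, rfl⟩
      fin_cases i
      · exact .inl rfl
      · exact .inr (.inl rfl)
      · exact .inr (.inr rfl)
  have hmem : ∀ i, s i ∈ T.fullGroup := fun i => by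
    rw [hfull]; exact Subgroup.subset_closure ⟨i, rfl⟩
  refine ⟨c, s, hcon, hs, hfull, fun g hg i => ?_⟩
  have hedge : T.IsEdge T.R r (g c) (g (s i c)) ∨ T.IsEdge T.P p (g c) (g (s i c)) →
      (T.graph r p).edist (g c) (g (s i c)) ≤ 1 := fun h => by
    by_cases he : g c = g (s i c)
    · rw [← he, SimpleGraph.edist_self]; exact zero_le_one
    · have hadj : (T.graph r p).Adj (g c) (g (s i c)) :=
        (SimpleGraph.fromRel_adj _ _ _).2 ⟨he, .inl h⟩
      simpa using hadj.toWalk.edist_le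
  -- The reflection in [P,Q] gives an edge around P, the one in [Q,R] an edge around R, and the one
  -- in [R,P] fixes the contact point.
  fin_cases i
  · obtain ⟨h1, h2, h3⟩ := angle_vertex (V := ![T.R, T.P, T.Q]) (k := 1) (j := 0) (by decide)
      (ne_of_angles' hm hV 1) (hs 0) (hm 1) (altitude_eq_right hm hV 1) ha
      (by rw [hcab, add_comm]; rfl)
    exact hedge (.inr (isEdge_of_reflection hcon hg (hmem 0) h1 h2 h3))
  · obtain ⟨h1, h2, h3⟩ := angle_vertex (V := ![T.R, T.P, T.Q]) (k := 0) (j := 1) (by decide)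
      (ne_of_angles hm hV 0) (hs 1) (hm 0) (altitude_eq_left hm hV 0) hb hcab
    exact hedge (.inl (isEdge_of_reflection hcon hg (hmem 1) h1 h2 h3))
  · have : s 2 c = c := vec_injective (by
      rw [hs, mrefl, hcab, map_add, map_smul, map_smul, normal_orthogonal _ (by decide),
        normal_orthogonal _ (by decide)]
      simp)
    change (T.graph r p).edist (g c) (g (s 2 c)) ≤ 1
    rw [this, SimpleGraph.edist_self]
    exact zero_le_one

/-- Elements of the group are given by words. -/
theorem exists_word {D : TriangleDatum (ℝ × ℝ × ℝ)} {s : Fin 3 → ℍ ≃ᵢ ℍ}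
    (hs : ∀ i z, vec (s i z) = D.refl i (vec z)) {γ : ℍ ≃ᵢ ℍ}
    (hγ : γ ∈ Subgroup.closure (Set.range s)) : ∃ l, ∀ z, vec (γ z) = D.wp l (vec z) := by
  induction hγ using Subgroup.closure_induction with
  | mem γ h =>
    obtain ⟨i, rfl⟩ := h
    exact ⟨[i], fun z => by simp [hs]⟩
  | one => exact ⟨[], fun z => by simp⟩
  | mul γ γ' _ _ h h' =>
    obtain ⟨l, hl⟩ := h
    obtain ⟨l', hl'⟩ := h'
    exact ⟨l ++ l', fun z => by
      rw [IsometryEquiv.mul_apply, hl, hl', RootDatum.wp_append, Module.End.mul_apply]⟩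
  | inv γ _ h =>
    obtain ⟨l, hl⟩ := h
    refine ⟨l.reverse, fun z => ?_⟩
    conv_rhs => rw [← IsometryEquiv.apply_inv_self γ z, hl, RootDatum.wp_reverse_wp]

theorem iso_mem (s : Fin 3 → ℍ ≃ᵢ ℍ) (l : List (Fin 3)) :
    iso s l ∈ Subgroup.closure (Set.range s) :=
  Subgroup.list_prod_mem _ fun x hx => by
    obtain ⟨i, -, rfl⟩ := List.mem_map.1 hx
    exact Subgroup.subset_closure ⟨i, rfl⟩

/-- The prefixes of the word carry `c` along a path: successive prefixes differ by a generator on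
the right, which costs at most one edge. -/
theorem edist_iso_le {G : SimpleGraph ℍ} {s : Fin 3 → ℍ ≃ᵢ ℍ} {H : Subgroup (ℍ ≃ᵢ ℍ)} {c : ℍ}
    (hH : ∀ i, s i ∈ H) (h : ∀ g ∈ H, ∀ i, G.edist (g c) (g (s i c)) ≤ 1) {g : ℍ ≃ᵢ ℍ}
    (hg : g ∈ H) (l : List (Fin 3)) : G.edist (g c) (g (iso s l c)) ≤ l.length := by
  induction l generalizing g with
  | nil => simp [iso]
  | cons i l ih =>
    have h1 := ih (mul_mem hg (hH i))
    have h2 : iso s (i :: l) = s i * iso s l := by simp [iso]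
    rw [h2]
    calc G.edist (g c) (g ((s i * iso s l) c))
        ≤ G.edist (g c) (g (s i c)) + G.edist (g (s i c)) (g ((s i * iso s l) c)) :=
          G.edist_triangle
      _ ≤ 1 + l.length := add_le_add (h g hg i) h1
      _ = ((i :: l).length : ℕ) := by rw [List.length_cons, add_comm]; push_cast; rfl

theorem four_le_of_sum_lt {r p q : ℕ} (hr : 3 ≤ r) (hrp : r ≤ p) (hpq : p ≤ q)
    (h : (1 / r + 1 / p + 1 / q : ℝ) < 1) : 4 ≤ q := by
  by_contra hq
  obtain rfl : r = 3 := by omega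
  obtain rfl : p = 3 := by omega
  obtain rfl : q = 3 := by omega
  norm_num at h

end TriangleGroup

/-! ### The uniform bound -/

open TriangleGroup in
theorem proposition1 (l₀ : ℝ) (hl₀ : 0 < l₀) :
    ∃ n₀ : ℕ, ∀ r p q : ℕ, 3 ≤ r → r ≤ p → p ≤ q →
      (1 / r + 1 / p + 1 / q : ℝ) < 1 →
      ∀ T : TriangleGroup.Triangle, T.HasAngles r p q →
      ∀ γ ∈ T.group, TriangleGroup.IsHyperbolic γ →
        TriangleGroup.translationLength γ ≤ l₀ → T.lambdaStar r p γ < n₀ := by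
  -- Since 1 + κ ≤ cosh(l₀ + 1) and C ≥ 1, these choices give 20κ < C ≤ C² and 2(1 + κ) < N.
  obtain ⟨C, hC⟩ := exists_nat_gt (20 * Real.cosh (l₀ + 1))
  obtain ⟨N, hN⟩ := exists_nat_gt (2 * Real.cosh (l₀ + 1))
  refine ⟨N * (2 * C + 1) + 1, fun r p q hr hrp hpq hsum T hT γ hγ hhyp hlen => ?_⟩
  have hm : ∀ k, 3 ≤ ![r, p, q] k := fun k => by
    fin_cases k
    · exact hr
    · exact hr.trans hrp
    · exact (hr.trans hrp).trans hpq
  have hV : ∀ k, angle (![T.R, T.P, T.Q] k) (![T.R, T.P, T.Q] (k + 1)) (![T.R, T.P, T.Q] (k + 2)) =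
      Real.pi / (![r, p, q] k : ℕ) := fun k => by
    fin_cases k
    · exact hT.1
    · exact hT.2.1
    · exact hT.2.2
  obtain ⟨c, s, hc, hs, hfull, hdist⟩ := T.exists_generators hm hV
  set D := triangleDatum ![T.R, T.P, T.Q] ![r, p, q] hm
    ⟨2, four_le_of_sum_lt hr hrp hpq hsum⟩ hV with hD
  have hs' : ∀ i z, vec (s i z) = D.refl i (vec z) := fun i z => by
    rw [hs, RootDatum.refl_apply]; rfl
  obtain ⟨κ, n, hκ, hn, hcosh, z, hz, hγz⟩ := hhyp.exists_normal
  have hκ' : 1 + κ ≤ Real.cosh (l₀ + 1) := by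
    -- A point displaced by less than l₀ + 1 suffices, so attainment of the infimum plays no role.
    obtain ⟨x, hx⟩ := exists_lt_of_ciInf_lt (hlen.trans_lt (lt_add_one l₀))
    have h1 : Real.cosh (dist x (γ x)) ≤ Real.cosh (l₀ + 1) := by
      rw [Real.cosh_le_cosh, abs_of_nonneg dist_nonneg, abs_of_pos (by linarith)]
      exact hx.le
    rw [hcosh] at h1
    nlinarith [mul_nonneg hκ.le (sq_nonneg (mink (vec x) n))]
  obtain ⟨I, ρ, hρ, hI⟩ := exists_incenter hm hV
  obtain ⟨l, hl⟩ := exists_mem_chamber (D := D) rfl hs' hρ hI z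
  obtain ⟨lγ, hlγ⟩ := exists_word hs' (hfull ▸ hγ.1)
  have hDB : D.B = mink := rfl
  have hux : D.wp (l.reverse ++ (lγ ++ l)) (D.wp l.reverse (vec z)) =
      D.wp l.reverse (vec (γ z)) := by
    rw [RootDatum.wp_append, RootDatum.wp_append, Module.End.mul_apply, Module.End.mul_apply,
      RootDatum.wp_wp_reverse, hlγ]
  have hC1 : (1 : ℝ) ≤ C := by
    have := Real.one_le_cosh (l₀ + 1)
    linarith
  have hle := D.len_le hκ (l := l.reverse ++ (lγ ++ l)) (n := D.wp l.reverse n) hl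
    (by rw [RootDatum.form_wp_wp, hDB, mink_vec_self])
    (by rw [RootDatum.form_wp_wp, hDB, hn])
    (by rw [RootDatum.form_wp_wp, hDB, hz])
    (by rw [hux, RootDatum.form_wp_wp, hDB, hγz])
    (by
      rw [hux, RootDatum.form_wp_wp, hDB, mink_vec, hcosh, mink_symm, hz]
      ring)
    (fun k w => by
      have h1 : vec (iso s (l ++ w) (![T.R, T.P, T.Q] k)) = D.wp l (D.wp w (D.vtx k)) := by
        rw [vec_iso hs', RootDatum.wp_append]; rfl
      have h2 := hcosh (iso s (l ++ w) (![T.R, T.P, T.Q] k))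
      have h3 := mink_vec (iso s (l ++ w) (![T.R, T.P, T.Q] k))
        (γ (iso s (l ++ w) (![T.R, T.P, T.Q] k)))
      rw [h2, hlγ, h1, ← hDB, RootDatum.form_wp_left, RootDatum.form_wp_left D.toRootDatum l _ n]
        at h3
      rw [RootDatum.wp_append, RootDatum.wp_append, Module.End.mul_apply, Module.End.mul_apply,
        h3]
      ring)
    (C := C) (N := N) (by nlinarith) (by linarith)
  obtain ⟨w, hw, hw'⟩ := D.exists_reduced (l.reverse ++ (lγ ++ l))
  have hmem : ∀ l, iso s l ∈ T.fullGroup := fun l => by rw [hfull]; exact iso_mem s l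
  -- `w` is a reduced word for the conjugate l⁻¹γl, so γl = lw and `w` leads from `iso s l c` to its
  -- image under γ.
  have hγc : γ (iso s l c) = iso s l (iso s w c) := vec_injective (by
    rw [hlγ, vec_iso hs', vec_iso hs', vec_iso hs', hw, RootDatum.wp_append, RootDatum.wp_append,
      Module.End.mul_apply, RootDatum.wp_wp_reverse, Module.End.mul_apply])
  have hE : iso s l c ∈ T.EStar := ⟨iso s l, hmem l, c, hc, rfl⟩
  calc T.lambdaStar r p γ ≤ T.DStar r p (iso s l c) (γ (iso s l c)) := iInf₂_le _ hE
    _ ≤ w.length := by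
      rw [hγc]
      exact edist_iso_le (fun i => by rw [hfull]; exact Subgroup.subset_closure ⟨i, rfl⟩) hdist
        (hmem l) w
    _ < ((N * (2 * C + 1) + 1 : ℕ) : ℕ∞) := by
      rw [hw']
      exact_mod_cast Nat.lt_succ_of_le hle
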